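/- There is an absolute constant $C>0$ such that the following holds. Let $n\ge 1$, and let $A=(A_{ij})$ be the adjacency matrix of an inhomogeneous Erdős–Rényi random graph $G(n,(p_{ij}))$, that is, a random symmetric $n\times n$ matrix with entries in $\{0,1\}$ whose entries $A_{ij}$, $i\le j$, are independent with $\mathbb P(A_{ij}=1)=p_{ij}$ (a graph without self-loops corresponds to $p_{ii}=0$ for all $i$). Let $d=\max_{i,j} n p_{ij}$. Given a realization of $A$ and a set $S$ of at most $10n/d$ vertices (any set of vertices if $d=0$), call a real symmetric $n\times n$ matrix $A'$ an admissible regularization of $A$ if it is obtained by reducing the weights of the edges incident to $S$ in an arbitrary way, so that all degrees become at most $2d$; that is, $0\le A'_{ij}\le A_{ij}$ for all $i,j$, $A'_{ij}=A_{ij}$ whenever $i,j\notin S$, and $\sum_{j} A'_{ij}\le 2d$ for all $i$. Then for every real $r\ge 1$, with probability at least $1-n^{-r}$, simultaneously for all sets $S$ of at most $10n/d$ vertices and all corresponding admissible regularizations $A'$, $$ \|A'-\mathbb E A\|\le C\,r^{3/2}\sqrt d , $$ where $\|\cdot\|$ is the spectral norm (the operator norm on Euclidean $\mathbb R^n$).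 -/

import Mathlib

open MeasureTheory ProbabilityTheory

/-- `A` is the (random) adjacency matrix of an inhomogeneous Erdős–Rényi graph `G(n, (p i j))`
on the vertex set `Fin n`: a random symmetric 0/1 matrix whose entries on and above the diagonal
are independent, with `ℙ (A i j = 1) = p i j`. Loops are allowed; the graph without loops is the
case `p i i = 0` for all `i`. -/
structure IsInhomogeneousER {n : ℕ} {Ω : Type*} [MeasurableSpace Ω] (μ : Measure Ω)
    (p : Matrix (Fin n) (Fin n) ℝ) (A : Ω → Matrix (Fin n) (Fin n) ℝ) : Prop where
  measurable_entry : ∀ i j, Measurable fun ω => A ω i j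
  zero_or_one : ∀ ω i j, A ω i j = 0 ∨ A ω i j = 1
  symm : ∀ ω, (A ω).IsSymm
  prob_edge : ∀ i j, μ.real {ω | A ω i j = 1} = p i j
  indep : iIndepFun
    (fun (e : {e : Fin n × Fin n // e.1 ≤ e.2}) (ω : Ω) => A ω e.1.1 e.1.2) μ

/-- The entrywise expectation `𝔼 A` of a random matrix. -/
noncomputable def expectedMatrix {n : ℕ} {Ω : Type*} [MeasurableSpace Ω] (μ : Measure Ω)
    (A : Ω → Matrix (Fin n) (Fin n) ℝ) : Matrix (Fin n) (Fin n) ℝ :=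
  Matrix.of fun i j => ∫ ω, A ω i j ∂μ

/-- The weighted degree of the vertex `i` in the network with weighted adjacency matrix `M`. -/
def weightedDegree {n : ℕ} (M : Matrix (Fin n) (Fin n) ℝ) (i : Fin n) : ℝ :=
  ∑ j, M i j

/-- `A'` is the adjacency matrix of a weighted undirected network obtained from the one with
adjacency matrix `A` by reducing (to arbitrary smaller nonnegative values) the weights of edges
incident to the vertices in `S`; all other edges keep their weight. -/
structure IsWeightReduction {n : ℕ} (A : Matrix (Fin n) (Fin n) ℝ) (S : Finset (Fin n))
    (A' : Matrix (Fin n) (Fin n) ℝ) : Prop where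
  symm : A'.IsSymm
  nonneg : ∀ i j, 0 ≤ A' i j
  le : ∀ i j, A' i j ≤ A i j
  eq_of_notMem : ∀ i j, i ∉ S → j ∉ S → A' i j = A i j

/-- The spectral norm of a square real matrix: the operator norm on Euclidean space. -/
noncomputable def matrixSpectralNorm {n : ℕ} (M : Matrix (Fin n) (Fin n) ℝ) : ℝ :=
  ‖Matrix.toEuclideanCLM (n := Fin n) (𝕜 := ℝ) M‖


/-!
The argument follows Kahn and Szemerédi. A net reduces the norm of `A' - 𝔼 A` to the sums
`∑ x i * y j * (A' i j - p i j)` over pairs of points `x`, `y` of a `1 / 2`-net of the unit ball.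

Call a pair `(i, j)` light if `|x i * y j| ≤ √d / n`. If nothing is reduced, Bernstein's inequality
bounds the light part by a multiple of `r * √d`, with a probability that survives the union bound
over the net. The reduced entries are arbitrary, so on the pairs which meet `S` one replaces the
coefficients by their absolute values, for which the unreduced entries give an upper bound. These
coefficients still obey Bernstein's inequality, and the union bound over the `2 ^ n` sets `S` costs
no more than that over the net. The correction is an expected mass of at most
`2 * ∑ |x i * y j| * p i j` over the pairs which meet `S`, and this is of order `√d` by
Cauchy-Schwarz since `#S = O(n / d)`.

For the heavy pairs the signs play no role. With high probability no block of `A` has much more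
weight than its mean, measured against the entropy of the choice of the block. This property
is inherited by every `A'` with `A' ≤ A`, and together with the bound on the degrees of `A'` it
controls a decomposition of `x` and `y` into dyadic levels, with geometric series as sums.
-/

open scoped Finset

section Bernoulli

variable {Ω : Type*} [MeasurableSpace Ω] {μ : Measure Ω} [IsProbabilityMeasure μ]

theorem integral_comp_of_zero_or_one {X : Ω → ℝ} (hX : Measurable X)
    (h01 : ∀ ω, X ω = 0 ∨ X ω = 1) (φ : ℝ → ℝ) :
    ∫ ω, φ (X ω) ∂μ = φ 0 + μ.real {ω | X ω = 1} * (φ 1 - φ 0) := by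
  have hset : MeasurableSet {ω | X ω = 1} := hX (measurableSet_singleton 1)
  have hφ : (fun ω => φ (X ω)) =
      fun ω => φ 0 + Set.indicator {ω | X ω = 1} (fun _ => φ 1 - φ 0) ω := by
    ext ω
    rcases h01 ω with h | h <;> simp [Set.indicator, h]
  rw [hφ, integral_add (integrable_const _) ((integrable_const _).indicator hset),
    integral_indicator_const _ hset]
  simp

theorem integral_exp_sum_le_of_zero_or_one {ι : Type*} [Fintype ι] {X : ι → Ω → ℝ}
    (hX : ∀ i, Measurable (X i)) (h01 : ∀ i ω, X i ω = 0 ∨ X i ω = 1) (hindep : iIndepFun X μ)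
    (c : ι → ℝ) :
    ∫ ω, Real.exp (∑ i, c i * X i ω) ∂μ ≤
      Real.exp (∑ i, μ.real {ω | X i ω = 1} * (Real.exp (c i) - 1)) := by
  simp only [Real.exp_sum]
  rw [hindep.integral_fun_prod_comp (f := fun i x => Real.exp (c i * x))
    (fun i => (hX i).aemeasurable) (fun i => by fun_prop)]
  refine Finset.prod_le_prod (fun i _ => integral_nonneg fun ω => (Real.exp_pos _).le)
    fun i _ => ?_
  rw [integral_comp_of_zero_or_one (hX i) (h01 i) (fun x => Real.exp (c i * x)), add_comm]
  simpa only [mul_zero, mul_one, Real.exp_zero] using Real.add_one_le_exp _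

end Bernoulli

theorem sum_sum_eq_sum_upper_triangle {ι R : Type*} [LinearOrder ι] [Fintype ι] [AddCommMonoid R]
    (f : ι → ι → R) :
    ∑ i, ∑ j, f i j = ∑ e : {e : ι × ι // e.1 ≤ e.2},
      (f e.1.1 e.1.2 + if e.1.1 = e.1.2 then 0 else f e.1.2 e.1.1) := by
  have hswap : ∑ i, ∑ j, (if j < i then f i j else 0) = ∑ i, ∑ j, if i < j then f j i else 0 :=
    Finset.sum_comm
  calc ∑ i, ∑ j, f i j
      = ∑ i, ∑ j, ((if i ≤ j then f i j else 0) + if j < i then f i j else 0) := by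
        refine Finset.sum_congr rfl fun i _ => Finset.sum_congr rfl fun j _ => ?_
        split_ifs with h h' <;> first | order | simp
    _ = ∑ i, ∑ j, ((if i ≤ j then f i j else 0) + if i < j then f j i else 0) := by
        simp only [Finset.sum_add_distrib, hswap]
    _ = ∑ i, ∑ j, if i ≤ j then f i j + (if i = j then 0 else f j i) else 0 := by
        refine Finset.sum_congr rfl fun i _ => Finset.sum_congr rfl fun j _ => ?_
        rcases lt_trichotomy i j with h | rfl | h
        · simp [h, h.le, h.ne]
        · simp
        · simp [not_lt.2 h.le, not_le.2 h]
    _ = _ := by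
        rw [← Fintype.sum_prod_type', ← Finset.sum_filter]
        exact Finset.sum_subtype _ (by simp)
          fun e : ι × ι => f e.1 e.2 + if e.1 = e.2 then 0 else f e.2 e.1

namespace IsInhomogeneousER

variable {n : ℕ} {Ω : Type*} [MeasurableSpace Ω] {μ : Measure Ω}
  {p : Matrix (Fin n) (Fin n) ℝ} {A : Ω → Matrix (Fin n) (Fin n) ℝ}

theorem prob_nonneg (h : IsInhomogeneousER μ p A) (i j : Fin n) : 0 ≤ p i j :=
  h.prob_edge i j ▸ measureReal_nonneg

theorem prob_symm (h : IsInhomogeneousER μ p A) : p.IsSymm :=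
  Matrix.IsSymm.ext fun i j => by simp only [← h.prob_edge, (h.symm _).apply i j]

variable [IsProbabilityMeasure μ]

theorem expectedMatrix_eq (h : IsInhomogeneousER μ p A) : expectedMatrix μ A = p := by
  ext i j
  simpa [expectedMatrix, h.prob_edge] using integral_comp_of_zero_or_one (μ := μ)
    (h.measurable_entry i j) (fun ω => h.zero_or_one ω i j) id

theorem integrable_exp_sum (h : IsInhomogeneousER μ p A) (w : Matrix (Fin n) (Fin n) ℝ) :
    Integrable (fun ω => Real.exp (∑ i, ∑ j, w i j * A ω i j)) μ := by
  have hmeas : Measurable fun ω => Real.exp (∑ i, ∑ j, w i j * A ω i j) :=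
    Real.measurable_exp.comp <| Finset.measurable_sum _ fun i _ => Finset.measurable_sum _
      fun j _ => (h.measurable_entry i j).const_mul _
  refine .of_bound hmeas.aestronglyMeasurable (Real.exp (∑ i, ∑ j, |w i j|))
    (.of_forall fun ω => ?_)
  rw [Real.norm_eq_abs, Real.abs_exp, Real.exp_le_exp]
  refine Finset.sum_le_sum fun i _ => Finset.sum_le_sum fun j _ => ?_
  rcases h.zero_or_one ω i j with h | h <;> simp [h, le_abs_self]

/- A weight `w i j + w j i` on an edge `i < j` costs `exp (w i j + w j i)`, which AM-GM splits into
the average of `exp (2 * w i j)` and `exp (2 * w j i)`; hence the factors `2` and `1 / 2`. -/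
theorem integral_exp_sum_le (h : IsInhomogeneousER μ p A) (w : Matrix (Fin n) (Fin n) ℝ) :
    ∫ ω, Real.exp (∑ i, ∑ j, w i j * A ω i j) ∂μ ≤
      Real.exp ((∑ i, ∑ j, p i j * (Real.exp (2 * w i j) - 1)) / 2) := by
  let c (e : {e : Fin n × Fin n // e.1 ≤ e.2}) : ℝ :=
    w e.1.1 e.1.2 + if e.1.1 = e.1.2 then 0 else w e.1.2 e.1.1
  have hfold ω : ∑ i, ∑ j, w i j * A ω i j = ∑ e, c e * A ω e.1.1 e.1.2 := by
    rw [sum_sum_eq_sum_upper_triangle]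
    refine Finset.sum_congr rfl fun e _ => ?_
    rw [(h.symm ω).apply e.1.1 e.1.2, add_mul, ite_mul, zero_mul]
  simp only [hfold]
  refine (integral_exp_sum_le_of_zero_or_one (fun e => h.measurable_entry _ _)
    (fun e ω => h.zero_or_one ω _ _) h.indep c).trans (Real.exp_le_exp.2 ?_)
  rw [sum_sum_eq_sum_upper_triangle, Finset.sum_div]
  refine Finset.sum_le_sum fun e _ => ?_
  have hsq (x : ℝ) : Real.exp (2 * x) = Real.exp x ^ 2 := by rw [← Real.exp_nat_mul]; norm_num
  rw [h.prob_edge, h.prob_symm.apply e.1.1 e.1.2]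
  simp only [c, hsq]
  split_ifs
  · rw [add_zero, add_zero, mul_div_assoc]
    refine mul_le_mul_of_nonneg_left ?_ (h.prob_nonneg _ _)
    linarith [sq_nonneg (Real.exp (w e.1.1 e.1.2) - 1)]
  · rw [← mul_add, mul_div_assoc, Real.exp_add]
    refine mul_le_mul_of_nonneg_left ?_ (h.prob_nonneg _ _)
    linarith [two_mul_le_add_sq (Real.exp (w e.1.1 e.1.2)) (Real.exp (w e.1.2 e.1.1))]

theorem prob_le_sum_mul_le (h : IsInhomogeneousER μ p A) (w : Matrix (Fin n) (Fin n) ℝ) (t : ℝ) :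
    μ.real {ω | t ≤ ∑ i, ∑ j, w i j * A ω i j} ≤
      Real.exp ((∑ i, ∑ j, p i j * (Real.exp (2 * w i j) - 1)) / 2 - t) := by
  have hmarkov := measure_ge_le_exp_mul_mgf (μ := μ) (X := fun ω => ∑ i, ∑ j, w i j * A ω i j) t
    zero_le_one (by simpa using h.integrable_exp_sum w)
  simp only [mgf, one_mul, neg_mul] at hmarkov
  calc _ ≤ _ := hmarkov
    _ ≤ Real.exp (-t) * Real.exp ((∑ i, ∑ j, p i j * (Real.exp (2 * w i j) - 1)) / 2) := by
        gcongr
        exact h.integral_exp_sum_le w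
    _ = _ := by rw [← Real.exp_add]; ring_nf

theorem prob_le_sum_mul_sub_le (h : IsInhomogeneousER μ p A) {a : Matrix (Fin n) (Fin n) ℝ}
    {l : ℝ} (hl : 0 < l) (ha : ∀ i j, |2 * (l * a i j)| ≤ 1) (t : ℝ) :
    μ.real {ω | t ≤ ∑ i, ∑ j, a i j * (A ω i j - p i j)} ≤
      Real.exp (2 * l ^ 2 * ∑ i, ∑ j, p i j * a i j ^ 2 - l * t) := by
  have hset : {ω | t ≤ ∑ i, ∑ j, a i j * (A ω i j - p i j)} =
      {ω | l * (t + ∑ i, ∑ j, a i j * p i j) ≤ ∑ i, ∑ j, l * a i j * A ω i j} := by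
    ext ω
    simp only [Set.mem_ofPred_eq, mul_assoc, ← Finset.mul_sum, mul_sub, Finset.sum_sub_distrib]
    rw [mul_le_mul_iff_right₀ hl, le_sub_iff_add_le]
  have hexp : ∑ i, ∑ j, p i j * (Real.exp (2 * (l * a i j)) - 1) ≤
      2 * l * ∑ i, ∑ j, a i j * p i j + 4 * l ^ 2 * ∑ i, ∑ j, p i j * a i j ^ 2 := by
    simp only [Finset.mul_sum, ← Finset.sum_add_distrib]
    refine Finset.sum_le_sum fun i _ => Finset.sum_le_sum fun j _ => ?_
    have hquad := (abs_le.1 (Real.abs_exp_sub_one_sub_id_le (ha i j))).2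
    calc p i j * (Real.exp (2 * (l * a i j)) - 1)
        ≤ p i j * (2 * (l * a i j) + (2 * (l * a i j)) ^ 2) :=
          mul_le_mul_of_nonneg_left (by linarith) (h.prob_nonneg i j)
      _ = _ := by ring
  rw [hset]
  refine (h.prob_le_sum_mul_le (fun i j => l * a i j) _).trans (Real.exp_le_exp.2 ?_)
  linarith

end IsInhomogeneousER

/-- The logarithm `m * log (e * N / m)` of the standard upper bound on the number of subsets of size
at most `m` of a set of size `N`. -/
noncomputable def entropyWeight (N m : ℝ) : ℝ := m * (1 + Real.log (N / m))

theorem one_add_log_le_entropyWeight {N m : ℝ} (hm : 1 ≤ m) (hmN : m ≤ N) :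
    1 + Real.log N ≤ entropyWeight N m := by
  rw [entropyWeight, Real.log_div (by linarith) (by linarith)]
  nlinarith [Real.log_le_log (by linarith) hmN, Real.log_le_sub_one_of_pos (by linarith : 0 < m)]

theorem card_filter_card_le_exp_entropyWeight {ι : Type*} [Fintype ι] {m : ℕ} (hm : 0 < m)
    (hmι : m ≤ Fintype.card ι) :
    (#{I : Finset ι | #I ≤ m} : ℝ) ≤ Real.exp (entropyWeight (Fintype.card ι) m) := by
  have hm' : (0 : ℝ) < m := Nat.cast_pos.2 hm
  set N := (Fintype.card ι : ℝ) with hN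
  have hmN : (m : ℝ) ≤ N := Nat.cast_le.2 hmι
  have hN' : 0 < N := hm'.trans_le hmN
  have hq : 0 < m / N := by positivity
  have hq1 : m / N ≤ 1 := (div_le_one hN').2 hmN
  have hexp : Real.exp (entropyWeight N m) * (m / N) ^ m = Real.exp m := by
    rw [← Real.exp_log (pow_pos hq m), ← Real.exp_add, entropyWeight, Real.log_pow,
      Real.log_div hN'.ne' hm'.ne', Real.log_div hm'.ne' hN'.ne']
    ring_nf
  refine le_of_mul_le_mul_right ?_ (pow_pos hq m)
  calc (#{I : Finset ι | #I ≤ m} : ℝ) * (m / N) ^ m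
      = ∑ I : Finset ι with #I ≤ m, (m / N) ^ m := by rw [Finset.sum_const, nsmul_eq_mul]
    _ ≤ ∑ I : Finset ι with #I ≤ m, (m / N) ^ #I :=
        Finset.sum_le_sum fun I hI => pow_le_pow_of_le_one hq.le hq1 (Finset.mem_filter.1 hI).2
    _ ≤ ∑ I : Finset ι, (m / N) ^ #I := Finset.sum_le_univ_sum_of_nonneg fun I => by positivity
    _ = (m / N + 1) ^ Fintype.card ι := by
        simpa using Fintype.sum_pow_mul_eq_add_pow ι (m / N) 1
    _ ≤ Real.exp (m / N) ^ Fintype.card ι := by gcongr; exact Real.add_one_le_exp _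
    _ = Real.exp m := by rw [← Real.exp_nat_mul, ← hN, mul_div_cancel₀ _ hN'.ne']
    _ = _ := hexp.symm

/-- A nonnegative quantity `E` of mean at most `ν` does not exceed `ν` by too much: either it is at
most `exp 2 * ν`, or its large deviation cost `E * log (E / ν)` is at most `h`. -/
def DiscrepancyBound (ν h E : ℝ) : Prop :=
  E ≤ Real.exp 2 * ν ∨ E * Real.log (E / ν) ≤ h

theorem DiscrepancyBound.mono {ν h E E' : ℝ} (hE : DiscrepancyBound ν h E) (hν : 0 < ν)
    (hle : E' ≤ E) : DiscrepancyBound ν h E' := by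
  rcases le_or_gt E' (Real.exp 2 * ν) with hE' | hE'
  · exact .inl hE'
  · refine hE.imp hle.trans fun hE => le_trans ?_ hE
    have hpos : 0 < Real.exp 2 * ν := by positivity
    have hlog : 2 ≤ Real.log (E' / ν) :=
      (Real.le_log_iff_exp_le (div_pos (hpos.trans hE') hν)).2 ((le_div_iff₀ hν).2 hE'.le)
    have hE'ν : 0 < E' / ν := div_pos (hpos.trans hE') hν
    gcongr
    linarith

theorem exists_threshold_discrepancyBound {ν : ℝ} (hν : 0 < ν) (h : ℝ) :
    ∃ k, Real.exp 2 * ν ≤ k ∧ h ≤ k * Real.log (k / ν) ∧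
      ∀ E, ¬DiscrepancyBound ν h E → k ≤ E := by
  let T : Set ℝ := Set.Ici (Real.exp 2 * ν) ∩ (fun k => k * Real.log (k / ν)) ⁻¹' Set.Ici h
  have hpos : 0 < Real.exp 2 * ν := by positivity
  have hcont : ContinuousOn (fun k => k * Real.log (k / ν)) (Set.Ici (Real.exp 2 * ν)) :=
    continuousOn_id.mul <| (continuousOn_id.div_const ν).log fun k hk =>
      (div_pos (hpos.trans_le hk) hν).ne'
  have hbdd : BddBelow T := ⟨_, fun k hk => hk.1⟩
  have hne : T.Nonempty := by
    have hmax := le_max_left (Real.exp 2 * ν) h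
    have hlog : 2 ≤ Real.log (max (Real.exp 2 * ν) h / ν) :=
      (Real.le_log_iff_exp_le (div_pos (hpos.trans_le hmax) hν)).2 ((le_div_iff₀ hν).2 hmax)
    refine ⟨max (Real.exp 2 * ν) h, hmax, ?_⟩
    simp only [Set.mem_preimage, Set.mem_Ici]
    nlinarith [le_max_right (Real.exp 2 * ν) h]
  have hmem : sInf T ∈ T :=
    (hcont.preimage_isClosed_of_isClosed isClosed_Ici isClosed_Ici).csInf_mem hne hbdd
  refine ⟨sInf T, hmem.1, hmem.2, fun E hE => csInf_le hbdd ?_⟩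
  obtain ⟨h₁, h₂⟩ := not_or.1 hE
  exact ⟨(not_le.1 h₁).le, (not_le.1 h₂).le⟩

/-- The discrepancy property of a matrix of size about `N` and degrees about `d`: the total weight
of every block `I × J` with `0 < #I ≤ #J` satisfies the discrepancy bound for the mean
`d * #I * #J / N`, at a cost which is `c` times the entropy of the choice of the block. -/
def HasDiscrepancy {ι κ : Type*} (N d c : ℝ) (M : Matrix ι κ ℝ) : Prop :=
  ∀ ⦃I : Finset ι⦄ ⦃J : Finset κ⦄, I.Nonempty → #I ≤ #J →
    DiscrepancyBound (d * #I * #J / N) (c * entropyWeight N #J) (∑ i ∈ I, ∑ j ∈ J, M i j)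

theorem HasDiscrepancy.mono {ι κ : Type*} {N d c : ℝ} {M M' : Matrix ι κ ℝ}
    (hM : HasDiscrepancy N d c M) (hN : 0 < N) (hd : 0 < d) (hle : ∀ i j, M' i j ≤ M i j) :
    HasDiscrepancy N d c M' := fun I J hI hIJ => by
  have hI' : 0 < #I := hI.card_pos
  have hJ' : 0 < #J := hI'.trans_le hIJ
  exact (hM hI hIJ).mono (by positivity)
    (Finset.sum_le_sum fun i _ => Finset.sum_le_sum fun j _ => hle i j)

theorem sum_sum_ite_mem_and_mem {ι κ R : Type*} [Fintype ι] [Fintype κ] [DecidableEq ι]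
    [DecidableEq κ] [AddCommMonoid R] (I : Finset ι) (J : Finset κ) (f : ι → κ → R) :
    ∑ i, ∑ j, (if i ∈ I ∧ j ∈ J then f i j else 0) = ∑ i ∈ I, ∑ j ∈ J, f i j := by
  simp only [ite_and, Finset.sum_ite_mem, Finset.sum_ite_irrel, Finset.univ_inter,
    Finset.sum_const_zero]

namespace IsInhomogeneousER

variable {n : ℕ} {Ω : Type*} [MeasurableSpace Ω] {μ : Measure Ω} [IsProbabilityMeasure μ]
  {p : Matrix (Fin n) (Fin n) ℝ} {A : Ω → Matrix (Fin n) (Fin n) ℝ} {d : ℝ}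

theorem prob_le_block_sum_le (h : IsInhomogeneousER μ p A) {I J : Finset (Fin n)} {ν k : ℝ}
    (hν : 0 < ν) (hp : ∑ i ∈ I, ∑ j ∈ J, p i j ≤ ν) (hk : Real.exp 2 * ν ≤ k) :
    μ.real {ω | k ≤ ∑ i ∈ I, ∑ j ∈ J, A ω i j} ≤ Real.exp (-(k * Real.log (k / ν) / 4)) := by
  have hk' : 0 < k := (by positivity : 0 < Real.exp 2 * ν).trans_le hk
  set L := Real.log (k / ν) with hL
  have hexp : Real.exp L = k / ν := Real.exp_log (by positivity)
  have hL2 : 2 ≤ L := by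
    rw [hL, Real.le_log_iff_exp_le (by positivity), le_div_iff₀ hν]
    exact hk
  have hset : {ω | k ≤ ∑ i ∈ I, ∑ j ∈ J, A ω i j} =
      {ω | L / 2 * k ≤ ∑ i, ∑ j, (if i ∈ I ∧ j ∈ J then L / 2 else 0) * A ω i j} := by
    ext ω
    simp only [Set.mem_ofPred_eq, ite_mul, zero_mul,
      sum_sum_ite_mem_and_mem I J fun i j => L / 2 * A ω i j, ← Finset.mul_sum]
    rw [mul_le_mul_iff_right₀ (by linarith)]
  have hmgf : ∑ i, ∑ j, p i j * (Real.exp (2 * if i ∈ I ∧ j ∈ J then L / 2 else 0) - 1) ≤ k :=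
    calc _ = ∑ i, ∑ j, if i ∈ I ∧ j ∈ J then p i j * (Real.exp L - 1) else 0 := by
          refine Finset.sum_congr rfl fun i _ => Finset.sum_congr rfl fun j _ => ?_
          split_ifs
          · rw [mul_div_cancel₀ _ two_ne_zero]
          · simp
      _ = (∑ i ∈ I, ∑ j ∈ J, p i j) * (Real.exp L - 1) := by
          simp only [sum_sum_ite_mem_and_mem I J fun i j => p i j * (Real.exp L - 1),
            Finset.sum_mul]
      _ ≤ ν * (k / ν) := by
          have hone : 1 ≤ Real.exp L := Real.one_le_exp (by linarith)
          rw [← hexp]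
          exact mul_le_mul hp (by linarith) (by linarith) hν.le
      _ = k := mul_div_cancel₀ _ hν.ne'
  rw [hset]
  refine (h.prob_le_sum_mul_le (fun i j => if i ∈ I ∧ j ∈ J then L / 2 else 0) _).trans
    (Real.exp_le_exp.2 ?_)
  nlinarith

theorem prob_not_discrepancyBound_le (h : IsInhomogeneousER μ p A) {I J : Finset (Fin n)} {ν : ℝ}
    (hν : 0 < ν) (hp : ∑ i ∈ I, ∑ j ∈ J, p i j ≤ ν) (t : ℝ) :
    μ.real {ω | ¬DiscrepancyBound ν t (∑ i ∈ I, ∑ j ∈ J, A ω i j)} ≤ Real.exp (-(t / 4)) := by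
  obtain ⟨k, hk, htk, hsub⟩ := exists_threshold_discrepancyBound hν t
  calc _ ≤ μ.real {ω | k ≤ ∑ i ∈ I, ∑ j ∈ J, A ω i j} := measureReal_mono fun ω => hsub _
    _ ≤ Real.exp (-(k * Real.log (k / ν) / 4)) := h.prob_le_block_sum_le hν hp hk
    _ ≤ _ := by gcongr

theorem prob_exists_not_discrepancyBound_le (h : IsInhomogeneousER μ p A) (hd : 0 < d)
    (hp : ∀ i j, n * p i j ≤ d) {m : ℕ} (hm : 0 < m) (hmn : m ≤ n) (c : ℝ) :
    μ.real {ω | ∃ I J : Finset (Fin n), I.Nonempty ∧ #I ≤ m ∧ #J = m ∧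
        ¬DiscrepancyBound (d * #I * #J / n) (c * entropyWeight n #J)
          (∑ i ∈ I, ∑ j ∈ J, A ω i j)} ≤
      Real.exp (-((c / 4 - 2) * entropyWeight n m)) := by
  have hn : (0 : ℝ) < n := Nat.cast_pos.2 (hm.trans_le hmn)
  let F : Finset (Finset (Fin n)) := {I | #I ≤ m}
  let P : Finset (Finset (Fin n) × Finset (Fin n)) := {q ∈ F ×ˢ F | q.1.Nonempty ∧ #q.2 = m}
  let B (q : Finset (Fin n) × Finset (Fin n)) : Set Ω :=
    {ω | ¬DiscrepancyBound (d * #q.1 * #q.2 / n) (c * entropyWeight n #q.2)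
      (∑ i ∈ q.1, ∑ j ∈ q.2, A ω i j)}
  have hcard : (#P : ℝ) ≤ Real.exp (2 * entropyWeight n m) := by
    have hF : (#F : ℝ) ≤ Real.exp (entropyWeight n m) := by
      simpa using card_filter_card_le_exp_entropyWeight (ι := Fin n) hm (by simpa using hmn)
    calc (#P : ℝ) ≤ #F * #F := by
          exact_mod_cast (Finset.card_filter_le _ _).trans_eq (Finset.card_product F F)
      _ ≤ Real.exp (entropyWeight n m) * Real.exp (entropyWeight n m) := by gcongr
      _ = _ := by rw [← Real.exp_add, two_mul]
  have hB : ∀ q ∈ P, μ.real (B q) ≤ Real.exp (-(c * entropyWeight n m / 4)) := by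
    intro q hq
    obtain ⟨-, hI, rfl⟩ := Finset.mem_filter.1 hq
    have hI' : 0 < #q.1 := hI.card_pos
    refine h.prob_not_discrepancyBound_le (by positivity) ?_ _
    calc ∑ i ∈ q.1, ∑ j ∈ q.2, p i j ≤ ∑ _i ∈ q.1, ∑ _j ∈ q.2, d / n :=
          Finset.sum_le_sum fun i _ => Finset.sum_le_sum fun j _ => (le_div_iff₀' hn).2 (hp i j)
      _ = d * #q.1 * #q.2 / n := by simp only [Finset.sum_const, nsmul_eq_mul]; ring
  calc _ ≤ μ.real (⋃ q ∈ P, B q) := by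
        refine measureReal_mono (fun ω ⟨I, J, hI, hIm, hJ, hω⟩ => ?_) (measure_ne_top _ _)
        simp only [Set.mem_iUnion]
        exact ⟨(I, J), by simp [P, F, hI, hIm, hJ], hω⟩
    _ ≤ ∑ q ∈ P, μ.real (B q) := measureReal_biUnion_finset_le _ _
    _ ≤ #P * Real.exp (-(c * entropyWeight n m / 4)) := by
        simpa only [nsmul_eq_mul] using Finset.sum_le_card_nsmul P _ _ hB
    _ ≤ Real.exp (2 * entropyWeight n m) * Real.exp (-(c * entropyWeight n m / 4)) := by gcongr
    _ = _ := by rw [← Real.exp_add]; ring_nf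

theorem prob_not_hasDiscrepancy_le (h : IsInhomogeneousER μ p A) (hn : 0 < n) (hd : 0 < d)
    (hp : ∀ i j, n * p i j ≤ d) {r : ℝ} (hr : 0 ≤ r) :
    μ.real {ω | ¬HasDiscrepancy n d (4 * (r + 3)) (A ω)} ≤ (n : ℝ) ^ (-r) / 2 := by
  have hn' : (0 : ℝ) < n := Nat.cast_pos.2 hn
  let B (m : ℕ) : Set Ω := {ω | ∃ I J : Finset (Fin n), I.Nonempty ∧ #I ≤ m ∧ #J = m ∧
    ¬DiscrepancyBound (d * #I * #J / n) (4 * (r + 3) * entropyWeight n #J)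
      (∑ i ∈ I, ∑ j ∈ J, A ω i j)}
  have hB : ∀ m ∈ Finset.Icc 1 n, μ.real (B m) ≤ Real.exp (-((r + 1) * (1 + Real.log n))) := by
    intro m hm
    obtain ⟨hm1, hmn⟩ := Finset.mem_Icc.1 hm
    refine (h.prob_exists_not_discrepancyBound_le hd hp hm1 hmn _).trans (Real.exp_le_exp.2 ?_)
    have hW : 1 + Real.log n ≤ entropyWeight n m :=
      one_add_log_le_entropyWeight (Nat.one_le_cast.2 hm1) (Nat.cast_le.2 hmn)
    linarith [mul_le_mul_of_nonneg_left hW (by linarith : 0 ≤ r + 1)]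
  calc _ ≤ μ.real (⋃ m ∈ Finset.Icc 1 n, B m) := by
        refine measureReal_mono (fun ω hω => ?_) (measure_ne_top _ _)
        simp only [HasDiscrepancy, Set.mem_ofPred_eq, not_forall] at hω
        obtain ⟨I, J, hI, hIJ, hω⟩ := hω
        simp only [Set.mem_iUnion]
        exact ⟨#J, Finset.mem_Icc.2 ⟨hI.card_pos.trans_le hIJ, card_finset_fin_le J⟩,
          I, J, hI, hIJ, rfl, hω⟩
    _ ≤ ∑ m ∈ Finset.Icc 1 n, μ.real (B m) := measureReal_biUnion_finset_le _ _
    _ ≤ n * Real.exp (-((r + 1) * (1 + Real.log n))) := by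
        simpa using Finset.sum_le_card_nsmul _ _ _ hB
    _ = n ^ (-r) * Real.exp (-(r + 1)) := by
        rw [Real.rpow_def_of_pos hn']
        nth_rw 1 [← Real.exp_log hn']
        rw [← Real.exp_add, ← Real.exp_add]
        ring_nf
    _ ≤ n ^ (-r) * (1 / 2) := by
        gcongr
        rw [Real.exp_neg, one_div]
        gcongr
        linarith [Real.add_one_le_exp (r + 1)]
    _ = _ := by ring

end IsInhomogeneousER

/-- The truncation of `z` to the interval `[-τ, τ]` which sends values outside to zero. -/
noncomputable def cutoff (τ z : ℝ) : ℝ := if |z| ≤ τ then z else 0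

/-- The absolute value of the part of `z` removed by `cutoff θ`. -/
noncomputable def heavyPart (θ z : ℝ) : ℝ := if |z| ≤ θ then 0 else |z|

theorem cutoff_nonneg {τ z : ℝ} (hz : 0 ≤ z) : 0 ≤ cutoff τ z := by
  unfold cutoff
  split_ifs <;> simp only [hz, le_refl]

theorem cutoff_of_le {τ z : ℝ} (hz : 0 ≤ z) (hzτ : z ≤ τ) : cutoff τ z = z :=
  if_pos ((abs_of_nonneg hz).trans_le hzτ)

theorem sum_two_zpow_le {F : Finset ℤ} {m : ℤ} (hF : ∀ s ∈ F, s ≤ m) :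
    ∑ s ∈ F, (2 : ℝ) ^ s ≤ 2 * 2 ^ m := by
  induction F using Finset.induction_on_max generalizing m with
  | empty => simpa using (zpow_pos (zero_lt_two' ℝ) m).le
  | insert a s hs ih =>
    have hs' := ih fun x hx => Int.le_sub_one_of_lt (hs x hx)
    have ham : (2 : ℝ) ^ a ≤ 2 ^ m :=
      zpow_le_zpow_right₀ one_le_two (hF a (Finset.mem_insert_self _ _))
    rw [zpow_sub_one₀ two_ne_zero] at hs'
    rw [Finset.sum_insert fun h => (hs a h).false]
    linarith

theorem sum_cutoff_mul_two_zpow_le {τ k : ℝ} (hτ : 0 ≤ τ) (hk : 0 < k) (F : Finset ℤ) :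
    ∑ s ∈ F, cutoff τ (k * 2 ^ s) ≤ 2 * τ := by
  have habs (s : ℤ) : |k * (2 : ℝ) ^ s| = k * 2 ^ s := abs_of_pos (by positivity)
  simp only [cutoff, habs]
  rw [← Finset.sum_filter, ← Finset.mul_sum]
  set G := F.filter fun s : ℤ => k * 2 ^ s ≤ τ
  rcases G.eq_empty_or_nonempty with h | h
  · rw [h, Finset.sum_empty, mul_zero]
    positivity
  · have hsum : ∑ s ∈ G, (2 : ℝ) ^ s ≤ 2 * 2 ^ G.max' h := sum_two_zpow_le fun s => G.le_max' s
    have hmax : k * 2 ^ G.max' h ≤ τ := (Finset.mem_filter.1 (G.max'_mem h)).2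
    nlinarith

theorem sum_cutoff_div_two_zpow_le {τ k : ℝ} (hτ : 0 ≤ τ) (hk : 0 < k) (F : Finset ℤ) :
    ∑ s ∈ F, cutoff τ (k / 2 ^ s) ≤ 2 * τ := by
  simpa only [Finset.sum_image neg_injective.injOn, zpow_neg, ← div_eq_mul_inv] using
    sum_cutoff_mul_two_zpow_le hτ hk (F.image Neg.neg)

theorem sum_sum_mul_le {ι κ : Type*} {F : Finset ι} {G : Finset κ} {γ : ι → ℝ} {f : ι → κ → ℝ}
    {C : ℝ} (hC : 0 ≤ C) (hγ : ∀ s, 0 ≤ γ s) (hγ1 : ∑ s ∈ F, γ s ≤ 1)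
    (hf : ∀ s, ∑ t ∈ G, f s t ≤ C) : ∑ s ∈ F, ∑ t ∈ G, γ s * f s t ≤ C :=
  calc ∑ s ∈ F, ∑ t ∈ G, γ s * f s t ≤ ∑ s ∈ F, γ s * C :=
        Finset.sum_le_sum fun s _ => by
          rw [← Finset.mul_sum]
          exact mul_le_mul_of_nonneg_left (hf s) (hγ s)
    _ ≤ C := by
        rw [← Finset.sum_mul]
        exact mul_le_of_le_one_left hC hγ1

/-- For a block of `a` rows and `b` columns on which the entries of two vectors have sizes `u` and
`v`, a bound, up to a constant multiple of `w`, for the contribution `u * v * E` of a block weight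
`E`. Each of its summands has a sum over dyadic `u` and `v` bounded in terms of `∑ a * u ^ 2` and
`∑ b * v ^ 2` only. -/
noncomputable def dyadicMajorant (N w a b u v : ℝ) : ℝ :=
  a * u ^ 2 * (b * v ^ 2) + a * u ^ 2 * cutoff 4 (w / u * v) +
    b * v ^ 2 * cutoff 4 ((v * w)⁻¹ * u) + b * v ^ 2 * cutoff 4 (√N / w * u) +
    a * u ^ 2 * cutoff 4 (w / (N * u) / v)

section DyadicBlock

variable {N w a b u v E D c : ℝ}

theorem dyadicMajorant_nonneg (hN : 0 ≤ N) (hw : 0 ≤ w) (ha : 0 ≤ a) (hb : 0 ≤ b) (hu : 0 ≤ u)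
    (hv : 0 ≤ v) : 0 ≤ dyadicMajorant N w a b u v := by
  unfold dyadicMajorant
  repeat' first | positivity | apply add_nonneg | apply mul_nonneg | apply cutoff_nonneg

/- Write `N / b = V ^ 2 / β`. The logarithm in the cost is compared with `log l` first, and then its
two parts `1 + 2 * log V` and `log β⁻¹` with each other. -/
theorem deviation_cases {V β l h : ℝ} (hV : 0 < V) (hβ : 0 < β) (hE : 0 ≤ E) (hh : 0 ≤ h)
    (hl : 0 < l) (hl2 : 2 ≤ Real.log l) (hcost : E * Real.log l ≤ h * (1 + Real.log (V ^ 2 / β))) :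
    E ≤ 4 * h ∨ l ≤ 2 * V ∧ E ≤ 2 * h * V ∨ l * β ≤ 1 := by
  rcases le_or_gt (1 + Real.log (V ^ 2 / β)) (4 * Real.log l) with hlarge | hsmall
  · left
    refine le_of_mul_le_mul_right ?_ (by linarith : 0 < Real.log l)
    linarith [mul_le_mul_of_nonneg_left hlarge hh]
  right
  have hsplit : Real.log (V ^ 2 / β) = 2 * Real.log V + Real.log β⁻¹ := by
    rw [div_eq_mul_inv, Real.log_mul (by positivity) (by positivity), Real.log_pow, Nat.cast_ofNat]
  rcases le_or_gt (Real.log β⁻¹) (1 + 2 * Real.log V) with hβV | hVβ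
  · refine .inl ⟨(Real.log_le_log_iff hl (by positivity)).1 ?_, ?_⟩
    · rw [Real.log_mul two_ne_zero hV.ne']
      linarith [Real.log_two_gt_d9]
    · have hV' := Real.log_le_sub_one_of_pos hV
      have hcost' : h * (1 + Real.log (V ^ 2 / β)) ≤ h * (4 * V) :=
        mul_le_mul_of_nonneg_left (by linarith) hh
      linarith [mul_le_mul_of_nonneg_left hl2 hE]
  · right
    rw [← le_div_iff₀ hβ, one_div]
    exact (Real.log_le_log_iff hl (by positivity)).1 (by linarith)

theorem mul_mul_le_of_deviation_le (hN : 0 < N) (hw : 0 < w) (ha : 0 < a) (hb : 0 < b)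
    (hu : 0 < u) (hv : 0 < v) {l : ℝ} (hlV : l ≤ 2 * (√N * v))
    (hEV : l * (w ^ 2 * a * b / N) ≤ 2 * (c * b) * (√N * v)) :
    u * v * (l * (w ^ 2 * a * b / N)) ≤ 2 * c * w * (b * v ^ 2 * cutoff 4 (√N / w * u)) ∨
      u * v * (l * (w ^ 2 * a * b / N)) ≤ w * (a * u ^ 2 * (b * v ^ 2)) := by
  rcases le_or_gt (l * w) (N * u * v) with hlw | hlw
  · right
    calc u * v * (l * (w ^ 2 * a * b / N)) = w * (a * b * u * v / N) * (l * w) := by ring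
      _ ≤ w * (a * b * u * v / N) * (N * u * v) := by gcongr
      _ = _ := by field_simp
  · left
    have huw : √N * u ≤ 2 * w := by
      have hsqrt : 0 < √N := Real.sqrt_pos.2 hN
      refine le_of_mul_le_mul_right ?_ (mul_pos hsqrt hv)
      calc √N * u * (√N * v) = N * u * v := by
            rw [mul_mul_mul_comm, Real.mul_self_sqrt hN.le, mul_assoc]
        _ ≤ l * w := hlw.le
        _ ≤ 2 * (√N * v) * w := by gcongr
        _ = _ := by ring
    rw [cutoff_of_le (by positivity) (by rw [div_mul_eq_mul_div, div_le_iff₀ hw]; linarith)]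
    calc u * v * (l * (w ^ 2 * a * b / N)) ≤ u * v * (2 * (c * b) * (√N * v)) := by gcongr
      _ = _ := by field_simp

theorem mul_mul_le_of_large_deviation (hN : 0 < N) (hw : 0 < w) (ha : 0 < a) (hb : 0 < b)
    (hu : 0 < u) (hv : 0 < v) (hc : 0 ≤ c) (hheavy : w ≤ 4 * (N * u * v)) (hdeg : u < w * v)
    (hlarge : Real.exp 2 * (w ^ 2 * a * b / N) < E)
    (hcost : E * Real.log (E / (w ^ 2 * a * b / N)) ≤ c * entropyWeight N b) :
    u * v * E ≤ 4 * c * w * (b * v ^ 2 * cutoff 4 ((v * w)⁻¹ * u)) ∨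
      u * v * E ≤ 2 * c * w * (b * v ^ 2 * cutoff 4 (√N / w * u)) ∨
      u * v * E ≤ w * (a * u ^ 2 * (b * v ^ 2)) ∨
      u * v * E ≤ w * (a * u ^ 2 * cutoff 4 (w / (N * u) / v)) := by
  set ν := w ^ 2 * a * b / N with hν
  have hν0 : 0 < ν := by positivity
  have hE : 0 < E := (by positivity : 0 < Real.exp 2 * ν).trans hlarge
  obtain ⟨l, rfl⟩ : ∃ l, E = l * ν := ⟨E / ν, (div_mul_cancel₀ E hν0.ne').symm⟩
  rw [mul_div_cancel_right₀ _ hν0.ne'] at hcost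
  have hl : 0 < l := pos_of_mul_pos_left hE hν0.le
  have hl2 : 2 ≤ Real.log l :=
    (Real.le_log_iff_exp_le hl).2 (le_of_mul_le_mul_right hlarge.le hν0)
  have hNb : N / b = (√N * v) ^ 2 / (b * v ^ 2) := by
    rw [mul_pow, Real.sq_sqrt hN.le]
    field_simp
  rw [entropyWeight, hNb, ← mul_assoc] at hcost
  rcases deviation_cases (by positivity) (by positivity) hE.le (by positivity) hl hl2 hcost with
    hsmall | ⟨hlV, hEV⟩ | hlβ
  · left
    rw [cutoff_of_le (by positivity) (by rw [inv_mul_le_iff₀ (by positivity)]; nlinarith)]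
    calc u * v * (l * ν) ≤ u * v * (4 * (c * b)) := by gcongr
      _ = _ := by field_simp
  · rcases mul_mul_le_of_deviation_le hN hw ha hb hu hv hlV hEV with h | h
    · exact .inr (.inl h)
    · exact .inr (.inr (.inl h))
  · refine .inr (.inr (.inr ?_))
    rw [cutoff_of_le (by positivity) (by
      rw [div_div, div_le_iff₀ (by positivity)]; exact hheavy)]
    calc u * v * (l * ν) = w * (a * u ^ 2 * (w / (N * u) / v)) * (l * (b * v ^ 2)) := by
          rw [hν]; field_simp
      _ ≤ _ := mul_le_of_le_one_right (by positivity) hlβ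

theorem mul_mul_le_dyadicMajorant (hN : 0 < N) (hw : 0 < w) (ha : 0 < a) (hb : 0 < b)
    (hu : 0 < u) (hv : 0 < v) (hD : 0 ≤ D) (hc : 0 ≤ c) (hheavy : w ≤ 4 * (N * u * v))
    (hdeg : E ≤ D * w ^ 2 * a)
    (hdisc : DiscrepancyBound (w ^ 2 * a * b / N) (c * entropyWeight N b) E) :
    u * v * E ≤ (4 * Real.exp 2 + D + 4 * c) * w * dyadicMajorant N w a b u v := by
  have hα : 0 < a * u ^ 2 := by positivity
  have hβ : 0 < b * v ^ 2 := by positivity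
  have h₁ : 0 ≤ a * u ^ 2 * (b * v ^ 2) := by positivity
  have h₂ : 0 ≤ a * u ^ 2 * cutoff 4 (w / u * v) := mul_nonneg hα.le (cutoff_nonneg (by positivity))
  have h₃ : 0 ≤ b * v ^ 2 * cutoff 4 ((v * w)⁻¹ * u) :=
    mul_nonneg hβ.le (cutoff_nonneg (by positivity))
  have h₄ : 0 ≤ b * v ^ 2 * cutoff 4 (√N / w * u) :=
    mul_nonneg hβ.le (cutoff_nonneg (by positivity))
  have h₅ : 0 ≤ a * u ^ 2 * cutoff 4 (w / (N * u) / v) :=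
    mul_nonneg hα.le (cutoff_nonneg (by positivity))
  have hexp : 1 ≤ Real.exp 2 := Real.one_le_exp zero_le_two
  have hterm {C X : ℝ} (hE : u * v * E ≤ C * w * X) (hC : C ≤ 4 * Real.exp 2 + D + 4 * c)
      (hX : 0 ≤ X) (hXle : X ≤ dyadicMajorant N w a b u v) :
      u * v * E ≤ (4 * Real.exp 2 + D + 4 * c) * w * dyadicMajorant N w a b u v :=
    hE.trans (by gcongr)
  unfold dyadicMajorant at hterm ⊢
  rcases le_or_gt E (Real.exp 2 * (w ^ 2 * a * b / N)) with hmean | hlarge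
  · refine hterm (C := 4 * Real.exp 2) ?_ (by linarith) h₁ (by linarith)
    calc u * v * E ≤ u * v * (Real.exp 2 * (w ^ 2 * a * b / N)) := by gcongr
      _ = Real.exp 2 * (u * v * w * a * b / N) * w := by ring
      _ ≤ Real.exp 2 * (u * v * w * a * b / N) * (4 * (N * u * v)) := by gcongr
      _ = _ := by field_simp
  rcases le_or_gt (w * v) u with hwv | huw
  · refine hterm (C := D) ?_ (by linarith) h₂ (by linarith)
    rw [cutoff_of_le (by positivity) (by rw [div_mul_eq_mul_div, div_le_iff₀ hu]; linarith)]
    calc u * v * E ≤ u * v * (D * w ^ 2 * a) := by gcongr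
      _ = _ := by field_simp
  rcases mul_mul_le_of_large_deviation hN hw ha hb hu hv hc hheavy huw hlarge
    (hdisc.resolve_left hlarge.not_ge) with h | h | h | h
  · exact hterm h (by linarith) h₃ (by linarith)
  · exact hterm h (by linarith) h₄ (by linarith)
  · exact hterm (C := 1) (by rwa [one_mul]) (by linarith) h₁ (by linarith)
  · exact hterm (C := 1) (by rwa [one_mul]) (by linarith) h₅ (by linarith)

end DyadicBlock

theorem sum_dyadicMajorant_le {N w : ℝ} (hN : 0 < N) (hw : 0 < w) {a b : ℤ → ℝ} (ha : ∀ s, 0 ≤ a s)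
    (hb : ∀ t, 0 ≤ b t) {F G : Finset ℤ} (haF : ∑ s ∈ F, a s * (2 ^ s) ^ 2 ≤ 1)
    (hbG : ∑ t ∈ G, b t * (2 ^ t) ^ 2 ≤ 1) :
    ∑ s ∈ F, ∑ t ∈ G, dyadicMajorant N w (a s) (b t) (2 ^ s) (2 ^ t) ≤ 33 := by
  have hα s : 0 ≤ a s * ((2 : ℝ) ^ s) ^ 2 := mul_nonneg (ha s) (by positivity)
  have hβ t : 0 ≤ b t * ((2 : ℝ) ^ t) ^ 2 := mul_nonneg (hb t) (by positivity)
  have h₁ := sum_sum_mul_le zero_le_one hα haF fun _ => hbG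
  have h₂ := sum_sum_mul_le (by norm_num) hα haF fun s =>
    sum_cutoff_mul_two_zpow_le zero_le_four (by positivity : 0 < w / 2 ^ s) G
  have h₃ := sum_sum_mul_le (by norm_num) hβ hbG fun t =>
    sum_cutoff_mul_two_zpow_le zero_le_four (by positivity : 0 < (2 ^ t * w)⁻¹) F
  have h₄ := sum_sum_mul_le (by norm_num) hβ hbG fun _ =>
    sum_cutoff_mul_two_zpow_le zero_le_four (by positivity : 0 < √N / w) F
  have h₅ := sum_sum_mul_le (by norm_num) hα haF fun s =>
    sum_cutoff_div_two_zpow_le zero_le_four (by positivity : 0 < w / (N * 2 ^ s)) G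
  rw [Finset.sum_comm] at h₃ h₄
  simp only [dyadicMajorant, Finset.sum_add_distrib]
  linarith

/-- The integer `s` with `2 ^ s ≤ |x i| < 2 ^ (s + 1)`; it is meaningless where `x i = 0`. -/
noncomputable def dyadicLevel {ι : Type*} (x : ι → ℝ) (i : ι) : ℤ := Int.log 2 |x i|

/-- The set of indices of the nonzero entries of `x` of a given dyadic level. -/
noncomputable def levelSet {ι : Type*} [Fintype ι] (x : ι → ℝ) (s : ℤ) : Finset ι :=
  {i | x i ≠ 0 ∧ dyadicLevel x i = s}

/-- The set of dyadic levels of a vector. -/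
noncomputable def dyadicLevels {ι : Type*} [Fintype ι] (x : ι → ℝ) : Finset ℤ :=
  Finset.univ.image (dyadicLevel x)

section LevelSet

variable {ι : Type*} [Fintype ι] {x : ι → ℝ}

theorem mem_levelSet {s : ℤ} {i : ι} : i ∈ levelSet x s ↔ x i ≠ 0 ∧ dyadicLevel x i = s := by
  simp [levelSet]

theorem two_zpow_le_of_mem_levelSet {s : ℤ} {i : ι} (hi : i ∈ levelSet x s) :
    (2 : ℝ) ^ s ≤ |x i| := by
  obtain ⟨hi0, rfl⟩ := mem_levelSet.1 hi
  exact_mod_cast Int.zpow_log_le_self (b := 2) one_lt_two (abs_pos.2 hi0)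

theorem abs_lt_of_mem_levelSet {s : ℤ} {i : ι} (hi : i ∈ levelSet x s) : |x i| < 2 * 2 ^ s := by
  obtain ⟨-, rfl⟩ := mem_levelSet.1 hi
  have := Int.lt_zpow_succ_log_self (b := 2) one_lt_two |x i|
  rwa [Nat.cast_ofNat, zpow_add_one₀ two_ne_zero, mul_comm] at this

theorem sum_eq_sum_levelSet {f : ι → ℝ} (hf : ∀ i, x i = 0 → f i = 0) :
    ∑ i, f i = ∑ s ∈ dyadicLevels x, ∑ i ∈ levelSet x s, f i := by
  have hmaps : ∀ i ∈ Finset.univ.filter fun i => x i ≠ 0, dyadicLevel x i ∈ dyadicLevels x :=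
    fun i _ => Finset.mem_image_of_mem _ (Finset.mem_univ i)
  calc ∑ i, f i = ∑ i with x i ≠ 0, f i :=
        (Finset.sum_filter_of_ne fun i _ hi => mt (hf i) hi).symm
    _ = ∑ s ∈ dyadicLevels x, ∑ i ∈ levelSet x s, f i := by
        rw [← Finset.sum_fiberwise_of_maps_to hmaps]
        simp only [levelSet, Finset.filter_filter]

theorem sum_card_levelSet_mul_le (x : ι → ℝ) :
    ∑ s ∈ dyadicLevels x, #(levelSet x s) * ((2 : ℝ) ^ s) ^ 2 ≤ ∑ i, x i ^ 2 := by
  rw [sum_eq_sum_levelSet (x := x) (f := (x · ^ 2)) fun i hi => by rw [hi, sq, mul_zero]]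
  refine Finset.sum_le_sum fun s _ => ?_
  rw [← nsmul_eq_mul]
  refine Finset.card_nsmul_le_sum _ _ _ fun i hi => ?_
  rw [← sq_abs (x i)]
  gcongr
  exact two_zpow_le_of_mem_levelSet hi

theorem sum_sum_eq_sum_levelSet {κ : Type*} [Fintype κ] {y : κ → ℝ} {f : ι → κ → ℝ}
    (hx : ∀ i j, x i = 0 → f i j = 0) (hy : ∀ i j, y j = 0 → f i j = 0) :
    ∑ i, ∑ j, f i j = ∑ s ∈ dyadicLevels x, ∑ t ∈ dyadicLevels y,
      ∑ i ∈ levelSet x s, ∑ j ∈ levelSet y t, f i j := by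
  rw [sum_eq_sum_levelSet fun i hi => Finset.sum_eq_zero fun j _ => hx i j hi]
  refine Finset.sum_congr rfl fun s _ => ?_
  rw [Finset.sum_comm, sum_eq_sum_levelSet fun j hj => Finset.sum_eq_zero fun i _ => hy i j hj]
  exact Finset.sum_congr rfl fun t _ => Finset.sum_comm

end LevelSet

section HeavyPart

theorem heavyPart_nonneg (θ z : ℝ) : 0 ≤ heavyPart θ z := by
  unfold heavyPart
  split_ifs <;> positivity

theorem heavyPart_le_abs (θ z : ℝ) : heavyPart θ z ≤ |z| := by
  unfold heavyPart
  split_ifs <;> simp only [abs_nonneg, le_refl]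

theorem heavyPart_of_le {θ z : ℝ} (hz : |z| ≤ θ) : heavyPart θ z = 0 := if_pos hz

variable {ι κ : Type*} [Fintype ι] [Fintype κ] {N w c D : ℝ} {M : Matrix ι κ ℝ}

theorem sum_levelSet_heavyPart_mul_le_of_card_le (hN : 0 < N) (hw : 0 < w) (hc : 0 ≤ c)
    (hD : 0 ≤ D) (hM : ∀ i j, 0 ≤ M i j) (hrow : ∀ i, ∑ j, M i j ≤ D * w ^ 2)
    (hdisc : HasDiscrepancy N (w ^ 2) c M) (x : ι → ℝ) (y : κ → ℝ) {s t : ℤ}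
    (hcard : #(levelSet x s) ≤ #(levelSet y t)) :
    ∑ i ∈ levelSet x s, ∑ j ∈ levelSet y t, heavyPart (w / N) (x i * y j) * M i j ≤
      4 * (4 * Real.exp 2 + D + 4 * c) * w *
        dyadicMajorant N w #(levelSet x s) #(levelSet y t) (2 ^ s) (2 ^ t) := by
  have hK : 0 ≤ 4 * (4 * Real.exp 2 + D + 4 * c) * w := by positivity
  have hmaj := dyadicMajorant_nonneg hN.le hw.le (Nat.cast_nonneg #(levelSet x s))
    (Nat.cast_nonneg #(levelSet y t)) (zpow_nonneg zero_le_two s) (zpow_nonneg zero_le_two t)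
  have hxy : ∀ i ∈ levelSet x s, ∀ j ∈ levelSet y t, |x i * y j| ≤ 4 * (2 ^ s * 2 ^ t) := by
    intro i hi j hj
    calc |x i * y j| = |x i| * |y j| := abs_mul _ _
      _ ≤ 2 * 2 ^ s * (2 * 2 ^ t) := by
          gcongr
          exacts [(abs_lt_of_mem_levelSet hi).le, (abs_lt_of_mem_levelSet hj).le]
      _ = _ := by ring
  rcases le_or_gt (4 * (2 ^ s * 2 ^ t)) (w / N) with hlight | hheavy
  · rw [Finset.sum_eq_zero fun i hi => Finset.sum_eq_zero fun j hj => by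
      rw [heavyPart_of_le ((hxy i hi j hj).trans hlight), zero_mul]]
    exact mul_nonneg hK hmaj
  rcases (levelSet x s).eq_empty_or_nonempty with hI | hI
  · rw [hI, Finset.sum_empty, ← hI]
    exact mul_nonneg hK hmaj
  have ha : (0 : ℝ) < #(levelSet x s) := Nat.cast_pos.2 hI.card_pos
  have hb : (0 : ℝ) < #(levelSet y t) := Nat.cast_pos.2 (hI.card_pos.trans_le hcard)
  have hdeg : ∑ i ∈ levelSet x s, ∑ j ∈ levelSet y t, M i j ≤ D * w ^ 2 * #(levelSet x s) := by
    rw [mul_comm, ← nsmul_eq_mul]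
    exact Finset.sum_le_card_nsmul _ _ _ fun i _ =>
      (Finset.sum_le_univ_sum_of_nonneg (hM i)).trans (hrow i)
  have hblock := mul_mul_le_dyadicMajorant hN hw ha hb (zpow_pos zero_lt_two s)
    (zpow_pos zero_lt_two t) hD hc (by linarith [(div_lt_iff₀' hN).1 hheavy]) hdeg (hdisc hI hcard)
  calc _ ≤ ∑ i ∈ levelSet x s, ∑ j ∈ levelSet y t, 4 * (2 ^ s * 2 ^ t) * M i j :=
        Finset.sum_le_sum fun i hi => Finset.sum_le_sum fun j hj =>
          mul_le_mul_of_nonneg_right ((heavyPart_le_abs _ _).trans (hxy i hi j hj)) (hM i j)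
    _ = 4 * (2 ^ s * 2 ^ t * ∑ i ∈ levelSet x s, ∑ j ∈ levelSet y t, M i j) := by
        simp only [← Finset.mul_sum, mul_assoc]
    _ ≤ _ := by linarith

theorem sum_levelSet_heavyPart_mul_le (hN : 0 < N) (hw : 0 < w) (hc : 0 ≤ c) (hD : 0 ≤ D)
    (hM : ∀ i j, 0 ≤ M i j) (hrow : ∀ i, ∑ j, M i j ≤ D * w ^ 2)
    (hcol : ∀ j, ∑ i, M i j ≤ D * w ^ 2) (hdisc : HasDiscrepancy N (w ^ 2) c M)
    (hdiscT : HasDiscrepancy N (w ^ 2) c M.transpose) (x : ι → ℝ) (y : κ → ℝ) (s t : ℤ) :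
    ∑ i ∈ levelSet x s, ∑ j ∈ levelSet y t, heavyPart (w / N) (x i * y j) * M i j ≤
      4 * (4 * Real.exp 2 + D + 4 * c) * w *
        (dyadicMajorant N w #(levelSet x s) #(levelSet y t) (2 ^ s) (2 ^ t) +
          dyadicMajorant N w #(levelSet y t) #(levelSet x s) (2 ^ t) (2 ^ s)) := by
  have hs := zpow_nonneg (zero_le_two (α := ℝ)) s
  have ht := zpow_nonneg (zero_le_two (α := ℝ)) t
  rcases le_total #(levelSet x s) #(levelSet y t) with hcard | hcard
  · refine (sum_levelSet_heavyPart_mul_le_of_card_le hN hw hc hD hM hrow hdisc x y hcard).trans ?_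
    gcongr
    exact le_add_of_nonneg_right
      (dyadicMajorant_nonneg hN.le hw.le (Nat.cast_nonneg _) (Nat.cast_nonneg _) ht hs)
  · have h := sum_levelSet_heavyPart_mul_le_of_card_le hN hw hc hD (M := M.transpose)
      (fun j i => hM i j) hcol hdiscT y x hcard
    simp only [Matrix.transpose_apply, mul_comm (y _)] at h
    rw [Finset.sum_comm]
    refine h.trans ?_
    gcongr
    exact le_add_of_nonneg_left
      (dyadicMajorant_nonneg hN.le hw.le (Nat.cast_nonneg _) (Nat.cast_nonneg _) hs ht)

theorem sum_heavyPart_mul_le (hN : 0 < N) (hw : 0 < w) (hc : 0 ≤ c) (hD : 0 ≤ D)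
    (hM : ∀ i j, 0 ≤ M i j) (hrow : ∀ i, ∑ j, M i j ≤ D * w ^ 2)
    (hcol : ∀ j, ∑ i, M i j ≤ D * w ^ 2) (hdisc : HasDiscrepancy N (w ^ 2) c M)
    (hdiscT : HasDiscrepancy N (w ^ 2) c M.transpose) {x : ι → ℝ} {y : κ → ℝ}
    (hx : ∑ i, x i ^ 2 ≤ 1) (hy : ∑ j, y j ^ 2 ≤ 1) :
    ∑ i, ∑ j, heavyPart (w / N) (x i * y j) * M i j ≤
      264 * (4 * Real.exp 2 + D + 4 * c) * w := by
  let Φ (s t : ℤ) : ℝ := dyadicMajorant N w #(levelSet x s) #(levelSet y t) (2 ^ s) (2 ^ t)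
  let Ψ (t s : ℤ) : ℝ := dyadicMajorant N w #(levelSet y t) #(levelSet x s) (2 ^ t) (2 ^ s)
  have hx' := (sum_card_levelSet_mul_le x).trans hx
  have hy' := (sum_card_levelSet_mul_le y).trans hy
  have hsumΦ : ∑ s ∈ dyadicLevels x, ∑ t ∈ dyadicLevels y, Φ s t ≤ 33 :=
    sum_dyadicMajorant_le hN hw (fun _ => Nat.cast_nonneg _) (fun _ => Nat.cast_nonneg _) hx' hy'
  have hsumΨ : ∑ s ∈ dyadicLevels x, ∑ t ∈ dyadicLevels y, Ψ t s ≤ 33 := by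
    rw [Finset.sum_comm]
    exact sum_dyadicMajorant_le hN hw (fun _ => Nat.cast_nonneg _) (fun _ => Nat.cast_nonneg _)
      hy' hx'
  have hzero {z : ℝ} (hz : z = 0) : heavyPart (w / N) z = 0 :=
    heavyPart_of_le (by rw [hz, abs_zero]; positivity)
  calc ∑ i, ∑ j, heavyPart (w / N) (x i * y j) * M i j
      = ∑ s ∈ dyadicLevels x, ∑ t ∈ dyadicLevels y, ∑ i ∈ levelSet x s, ∑ j ∈ levelSet y t,
          heavyPart (w / N) (x i * y j) * M i j :=
        sum_sum_eq_sum_levelSet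
          (fun i j hi => by rw [hzero (by rw [hi, zero_mul]), zero_mul])
          (fun i j hj => by rw [hzero (by rw [hj, mul_zero]), zero_mul])
    _ ≤ ∑ s ∈ dyadicLevels x, ∑ t ∈ dyadicLevels y,
          4 * (4 * Real.exp 2 + D + 4 * c) * w * (Φ s t + Ψ t s) :=
        Finset.sum_le_sum fun s _ => Finset.sum_le_sum fun t _ =>
          sum_levelSet_heavyPart_mul_le hN hw hc hD hM hrow hcol hdisc hdiscT x y s t
    _ = 4 * (4 * Real.exp 2 + D + 4 * c) * w * (∑ s ∈ dyadicLevels x, ∑ t ∈ dyadicLevels y, Φ s t +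
          ∑ s ∈ dyadicLevels x, ∑ t ∈ dyadicLevels y, Ψ t s) := by
        simp only [← Finset.mul_sum, Finset.sum_add_distrib]
    _ ≤ 4 * (4 * Real.exp 2 + D + 4 * c) * w * (33 + 33) := by gcongr
    _ = _ := by ring

end HeavyPart

section HalfNet

open Metric Module
open scoped NNReal

theorem packingNumber_closedBall_half_le (E : Type*) [NormedAddCommGroup E] [NormedSpace ℝ E]
    [FiniteDimensional ℝ E] :
    packingNumber (1 / 2) (closedBall (0 : E) 1) ≤ (5 ^ finrank ℝ E : ℕ) := by
  classical
  refine iSup₂_le fun C hC => iSup_le fun hsep => ?_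
  have hcard (s : Finset E) (hs : (s : Set E) ⊆ C) : #s ≤ 5 ^ finrank ℝ E := by
    rw [← s.card_image_of_injective (smul_right_injective E (two_ne_zero' ℝ))]
    refine Besicovitch.card_le_of_separated _ ?_ ?_
    · simp only [Finset.forall_mem_image]
      intro x hx
      have hx1 : ‖x‖ ≤ 1 := mem_closedBall_zero_iff.1 (hC (hs hx))
      rw [norm_smul, Real.norm_two]
      linarith
    · simp only [Finset.forall_mem_image]
      intro x hx y hy hxy
      have hdist : ((1 / 2 : ℝ≥0) : ENNReal) < edist x y :=
        hsep (hs hx) (hs hy) fun h => hxy (congrArg _ h)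
      rw [edist_nndist, ENNReal.coe_lt_coe, ← NNReal.coe_lt_coe, coe_nndist, dist_eq_norm] at hdist
      rw [← smul_sub, norm_smul, Real.norm_two]
      push_cast at hdist
      linarith
  by_contra! hlt
  obtain ⟨t, htC, ht⟩ := Set.exists_subset_encard_eq (Order.add_one_le_of_lt hlt)
  lift t to Finset E using Set.finite_of_encard_eq_coe (k := 5 ^ finrank ℝ E + 1)
    (by exact_mod_cast ht)
  have htcard := hcard t htC
  rw [Set.encard_coe_eq_coe_finsetCard] at ht
  norm_cast at ht
  lia

theorem exists_isCover_half_card_le (E : Type*) [NormedAddCommGroup E] [NormedSpace ℝ E]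
    [FiniteDimensional ℝ E] :
    ∃ N : Finset E, #N ≤ 5 ^ finrank ℝ E ∧ ↑N ⊆ closedBall (0 : E) 1 ∧
      IsCover (1 / 2) (closedBall (0 : E) 1) (N : Set E) := by
  have hle := (coveringNumber_le_packingNumber (1 / 2) _).trans (packingNumber_closedBall_half_le E)
  have htop := ne_top_of_le_ne_top (ENat.natCast_ne_top _) hle
  obtain ⟨N, hN⟩ := finite_minimalCover.exists_finset_coe
    (s := minimalCover (1 / 2) (closedBall (0 : E) 1))
  refine ⟨N, ?_, hN ▸ minimalCover_subset, hN ▸ isCover_minimalCover htop⟩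
  rw [← encard_minimalCover htop, ← hN, Set.encard_coe_eq_coe_finsetCard] at hle
  exact_mod_cast hle

variable {E : Type*} [NormedAddCommGroup E] {N : Set E} {B : ℝ}

theorem exists_norm_sub_le_half_of_isCover (hN : IsCover (1 / 2) (closedBall (0 : E) 1) N) {v : E}
    (hv : ‖v‖ ≤ 1) : ∃ x ∈ N, ‖v - x‖ ≤ 1 / 2 := by
  simpa [dist_eq_norm] using hN.subset_iUnion_closedBall (mem_closedBall_zero_iff.2 hv)

theorem norm_le_of_inner_le_of_isCover_half [InnerProductSpace ℝ E]
    (hN : IsCover (1 / 2) (closedBall (0 : E) 1) N) {v : E} (hB : ∀ x ∈ N, inner ℝ x v ≤ B) :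
    ‖v‖ ≤ 2 * B := by
  obtain ⟨x, hx, hvx⟩ := exists_norm_sub_le_half_of_isCover hN (v := ‖v‖⁻¹ • v) (by
    rw [norm_smul, norm_inv, norm_norm]
    exact inv_mul_le_one)
  have hnorm : inner ℝ (‖v‖⁻¹ • v) v = ‖v‖ := by
    rw [real_inner_smul_left, real_inner_self_eq_norm_mul_norm, ← mul_assoc, inv_mul_mul_self]
  calc ‖v‖ = 2 * (inner ℝ x v + inner ℝ (‖v‖⁻¹ • v - x) v) - ‖v‖ := by
        rw [← inner_add_left, add_sub_cancel, hnorm]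
        ring
    _ ≤ 2 * (B + 1 / 2 * ‖v‖) - ‖v‖ := by
        gcongr
        · exact hB x hx
        · exact (real_inner_le_norm _ _).trans (by gcongr)
    _ = 2 * B := by ring

theorem opNorm_le_of_isCover_half {F : Type*} [NormedSpace ℝ E] [NormedAddCommGroup F]
    [NormedSpace ℝ F] (hN : IsCover (1 / 2) (closedBall (0 : E) 1) N) {T : E →L[ℝ] F}
    (hB : ∀ y ∈ N, ‖T y‖ ≤ B) : ‖T‖ ≤ 2 * B := by
  obtain ⟨y₀, hy₀, -⟩ := exists_norm_sub_le_half_of_isCover hN (norm_zero.trans_le zero_le_one)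
  have hB0 : 0 ≤ B := (norm_nonneg _).trans (hB y₀ hy₀)
  have hle : ‖T‖ ≤ B + ‖T‖ * (1 / 2) := by
    refine T.opNorm_le_of_unit_norm (by positivity) fun v hv => ?_
    obtain ⟨y, hy, hvy⟩ := exists_norm_sub_le_half_of_isCover hN hv.le
    calc ‖T v‖ = ‖T y + T (v - y)‖ := by rw [← map_add, add_sub_cancel]
      _ ≤ ‖T y‖ + ‖T (v - y)‖ := norm_add_le _ _
      _ ≤ B + ‖T‖ * (1 / 2) := add_le_add (hB y hy) (T.le_opNorm_of_le hvy)
  linarith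

end HalfNet

theorem matrixSpectralNorm_le_of_isCover_half {n : ℕ} {M : Matrix (Fin n) (Fin n) ℝ}
    {N : Set (EuclideanSpace ℝ (Fin n))}
    (hN : Metric.IsCover (1 / 2) (Metric.closedBall 0 1) N) {B : ℝ}
    (hB : ∀ x ∈ N, ∀ y ∈ N, ∑ i, ∑ j, x i * y j * M i j ≤ B) : matrixSpectralNorm M ≤ 4 * B := by
  have hnet : ∀ y ∈ N, ‖Matrix.toEuclideanCLM (n := Fin n) (𝕜 := ℝ) M y‖ ≤ 2 * B := by
    refine fun y hy => norm_le_of_inner_le_of_isCover_half hN fun x hx => ?_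
    simp only [Matrix.inner_toEuclideanCLM, dotProduct, Matrix.mulVec, Finset.mul_sum]
    simpa only [mul_assoc, mul_comm (M _ _)] using hB x hx y hy
  calc matrixSpectralNorm M ≤ 2 * (2 * B) := opNorm_le_of_isCover_half hN hnet
    _ = 4 * B := by ring

section LightPart

theorem abs_cutoff_le {τ : ℝ} (hτ : 0 ≤ τ) (z : ℝ) : |cutoff τ z| ≤ τ := by
  unfold cutoff
  split_ifs with hz
  · exact hz
  · rwa [abs_zero]

theorem abs_cutoff_le_abs (τ z : ℝ) : |cutoff τ z| ≤ |z| := by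
  unfold cutoff
  split_ifs <;> simp only [abs_zero, abs_nonneg, le_refl]

theorem heavyPart_le_inv_mul_sq {θ : ℝ} (hθ : 0 < θ) (z : ℝ) : heavyPart θ z ≤ θ⁻¹ * z ^ 2 := by
  unfold heavyPart
  split_ifs with hz
  · positivity
  · rw [le_inv_mul_iff₀ hθ, ← sq_abs, sq]
    exact mul_le_mul_of_nonneg_right (not_le.1 hz).le (abs_nonneg z)

theorem sum_heavyPart_le {ι κ : Type*} [Fintype ι] [Fintype κ] {θ : ℝ} (hθ : 0 < θ)
    {Z : Matrix ι κ ℝ} (hZ : ∑ i, ∑ j, Z i j ^ 2 ≤ 1) :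
    ∑ i, ∑ j, heavyPart θ (Z i j) ≤ θ⁻¹ :=
  calc ∑ i, ∑ j, heavyPart θ (Z i j) ≤ ∑ i, ∑ j, θ⁻¹ * Z i j ^ 2 :=
        Finset.sum_le_sum fun i _ => Finset.sum_le_sum fun j _ => heavyPart_le_inv_mul_sq hθ _
    _ = θ⁻¹ * ∑ i, ∑ j, Z i j ^ 2 := by simp only [← Finset.mul_sum]
    _ ≤ θ⁻¹ := mul_le_of_le_one_right (inv_nonneg.2 hθ.le) hZ

theorem sum_sum_mul_le_sum_sum_mul {ι κ : Type*} [Fintype ι] [Fintype κ] {f p : Matrix ι κ ℝ}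
    {q : ℝ} (hf : ∀ i j, 0 ≤ f i j) (hp : ∀ i j, p i j ≤ q) :
    ∑ i, ∑ j, f i j * p i j ≤ (∑ i, ∑ j, f i j) * q := by
  simp only [Finset.sum_mul]
  exact Finset.sum_le_sum fun i _ => Finset.sum_le_sum fun j _ =>
    mul_le_mul_of_nonneg_left (hp i j) (hf i j)

theorem sum_sum_mul_sq_le_one {ι κ : Type*} [Fintype ι] [Fintype κ] {x : ι → ℝ} {y : κ → ℝ}
    (hx : ∑ i, x i ^ 2 ≤ 1) (hy : ∑ j, y j ^ 2 ≤ 1) : ∑ i, ∑ j, (x i * y j) ^ 2 ≤ 1 := by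
  simp only [mul_pow, ← Finset.sum_mul_sum]
  exact mul_le_one₀ hx (Finset.sum_nonneg fun j _ => sq_nonneg _) hy

theorem sum_sq_le_one_of_mem_closedBall {ι : Type*} [Fintype ι] {x : EuclideanSpace ℝ ι}
    (hx : x ∈ Metric.closedBall 0 1) : ∑ i, x i ^ 2 ≤ 1 := by
  rw [← EuclideanSpace.real_norm_sq_eq]
  exact pow_le_one₀ (norm_nonneg _) (mem_closedBall_zero_iff.1 hx)

variable {ι : Type*} [DecidableEq ι]

/-- The light part of the coefficient matrix `Z`, made nonnegative on the pairs which meet `S`.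
There the entries of a 0/1 matrix may be reduced arbitrarily, and the unreduced entries give an
upper bound only with nonnegative coefficients. -/
noncomputable def lightWeight (θ : ℝ) (S : Finset ι) (Z : Matrix ι ι ℝ) : Matrix ι ι ℝ :=
  Matrix.of fun i j => if i ∈ S ∨ j ∈ S then |cutoff θ (Z i j)| else cutoff θ (Z i j)

theorem abs_lightWeight (θ : ℝ) (S : Finset ι) (Z : Matrix ι ι ℝ) (i j : ι) :
    |lightWeight θ S Z i j| = |cutoff θ (Z i j)| := by
  unfold lightWeight
  rw [Matrix.of_apply]
  split_ifs <;> simp only [abs_abs]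

variable [Fintype ι]

theorem sum_lightWeight_sq_le (θ : ℝ) (S : Finset ι) (Z : Matrix ι ι ℝ) :
    ∑ i, ∑ j, lightWeight θ S Z i j ^ 2 ≤ ∑ i, ∑ j, Z i j ^ 2 :=
  Finset.sum_le_sum fun i _ => Finset.sum_le_sum fun j _ =>
    sq_le_sq.2 ((abs_lightWeight θ S Z i j).trans_le (abs_cutoff_le_abs θ _))

theorem sum_ite_mem_or_mem_abs_le (S : Finset ι) {Z : Matrix ι ι ℝ}
    (hZ : ∑ i, ∑ j, Z i j ^ 2 ≤ 1) :
    ∑ i, ∑ j, (if i ∈ S ∨ j ∈ S then |Z i j| else 0) ≤ √(2 * #S * Fintype.card ι) := by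
  have hcard : (#{e : ι × ι | e.1 ∈ S ∨ e.2 ∈ S} : ℝ) ≤ 2 * #S * Fintype.card ι := by
    have hsub : ({e : ι × ι | e.1 ∈ S ∨ e.2 ∈ S} : Finset (ι × ι)) =
        S ×ˢ Finset.univ ∪ Finset.univ ×ˢ S := by
      ext e
      simp
    have hunion := Finset.card_union_le (S ×ˢ Finset.univ) (Finset.univ ×ˢ S)
    rw [← hsub, Finset.card_product, Finset.card_product, Finset.card_univ] at hunion
    rw [mul_assoc, two_mul]
    exact_mod_cast hunion.trans_eq (by rw [mul_comm (Fintype.card ι)])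
  rw [← Fintype.sum_prod_type', ← Finset.sum_filter]
  calc ∑ e : ι × ι with e.1 ∈ S ∨ e.2 ∈ S, |Z e.1 e.2|
      ≤ √(∑ e : ι × ι with e.1 ∈ S ∨ e.2 ∈ S, |Z e.1 e.2| ^ 2) *
          √(∑ e : ι × ι with e.1 ∈ S ∨ e.2 ∈ S, 1 ^ 2) := by
        simpa only [mul_one] using Real.sum_mul_le_sqrt_mul_sqrt
          {e : ι × ι | e.1 ∈ S ∨ e.2 ∈ S} (fun e => |Z e.1 e.2|) fun _ => 1
    _ ≤ 1 * √(2 * #S * Fintype.card ι) := by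
        gcongr
        · refine Real.sqrt_le_one.2 (le_trans ?_ hZ)
          simp only [sq_abs]
          rw [← Fintype.sum_prod_type']
          exact Finset.sum_le_univ_sum_of_nonneg fun e => sq_nonneg _
        · simpa using hcard
    _ = _ := one_mul _

theorem sum_ite_mem_or_mem_abs_mul_le {S : Finset ι} {Z p : Matrix ι ι ℝ} {w K : ℝ} (hw : 0 ≤ w)
    (hp : ∀ i j, p i j ≤ w ^ 2 / Fintype.card ι) (hS : #S * w ^ 2 / Fintype.card ι ≤ K)
    (hZ : ∑ i, ∑ j, Z i j ^ 2 ≤ 1) :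
    ∑ i, ∑ j, (if i ∈ S ∨ j ∈ S then |Z i j| else 0) * p i j ≤ √(2 * K) * w := by
  have hsq : 2 * (#S * w ^ 2 / Fintype.card ι) =
      2 * #S * Fintype.card ι * (w / Fintype.card ι) ^ 2 := by
    field_simp
  calc ∑ i, ∑ j, (if i ∈ S ∨ j ∈ S then |Z i j| else 0) * p i j
      ≤ (∑ i, ∑ j, if i ∈ S ∨ j ∈ S then |Z i j| else 0) * (w ^ 2 / Fintype.card ι) :=
        sum_sum_mul_le_sum_sum_mul (fun i j => by split_ifs <;> positivity) hp
    _ ≤ √(2 * #S * Fintype.card ι) * (w ^ 2 / Fintype.card ι) := by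
        gcongr
        exact sum_ite_mem_or_mem_abs_le S hZ
    _ = √(2 * (#S * w ^ 2 / Fintype.card ι)) * w := by
        rw [hsq, Real.sqrt_mul' _ (sq_nonneg _), Real.sqrt_sq (by positivity)]
        ring
    _ ≤ √(2 * K) * w := by gcongr

end LightPart

namespace IsWeightReduction

variable {n : ℕ} {A A' p : Matrix (Fin n) (Fin n) ℝ} {S : Finset (Fin n)}

theorem sum_mul_sub_le (hA : IsWeightReduction A S A') (hp0 : ∀ i j, 0 ≤ p i j) (θ : ℝ)
    (Z : Matrix (Fin n) (Fin n) ℝ) :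
    ∑ i, ∑ j, Z i j * (A' i j - p i j) ≤
      ∑ i, ∑ j, lightWeight θ S Z i j * (A i j - p i j) +
        2 * ∑ i, ∑ j, (if i ∈ S ∨ j ∈ S then |Z i j| else 0) * p i j +
        ∑ i, ∑ j, heavyPart θ (Z i j) * A' i j + ∑ i, ∑ j, heavyPart θ (Z i j) * p i j := by
  simp only [Finset.mul_sum, ← Finset.sum_add_distrib]
  refine Finset.sum_le_sum fun i _ => Finset.sum_le_sum fun j _ => ?_
  have hp := hp0 i j
  have hle_abs {z t : ℝ} (ht : 0 ≤ t) : z * t ≤ |z| * t :=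
    mul_le_mul_of_nonneg_right (le_abs_self z) ht
  have hneg_le_abs {z t : ℝ} (ht : 0 ≤ t) : -(z * t) ≤ |z| * t :=
    (neg_mul z t).symm.trans_le (mul_le_mul_of_nonneg_right (neg_le_abs z) ht)
  have hA' := hle_abs (z := Z i j) (hA.nonneg i j)
  have hp' := hneg_le_abs (z := Z i j) hp
  simp only [lightWeight, Matrix.of_apply, cutoff, heavyPart]
  by_cases hlight : |Z i j| ≤ θ
  · by_cases hS : i ∈ S ∨ j ∈ S
    · have hAA' := mul_le_mul_of_nonneg_left (hA.le i j) (abs_nonneg (Z i j))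
      simp only [hlight, hS, if_true]
      linarith
    · rw [not_or] at hS
      simp [hlight, hS, hA.eq_of_notMem i j hS.1 hS.2]
  · have hinc : 0 ≤ (if i ∈ S ∨ j ∈ S then |Z i j| else 0) * p i j :=
      mul_nonneg (by split_ifs <;> positivity) hp
    simp only [hlight, if_false, abs_zero, ite_self, zero_mul]
    linarith

theorem bilinear_sub_le (hA : IsWeightReduction A S A') {w K D c B : ℝ} (hn : 0 < n) (hw : 0 < w)
    (hp0 : ∀ i j, 0 ≤ p i j) (hp : ∀ i j, n * p i j ≤ w ^ 2) (hS : #S * w ^ 2 ≤ K * n)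
    (hc : 0 ≤ c) (hD : 0 ≤ D) (hdeg : ∀ i, weightedDegree A' i ≤ D * w ^ 2)
    (hdisc : HasDiscrepancy n (w ^ 2) c A) {x y : Fin n → ℝ} (hx : ∑ i, x i ^ 2 ≤ 1)
    (hy : ∑ j, y j ^ 2 ≤ 1)
    (hlight : ∑ i, ∑ j, lightWeight (w / n) S (fun i j => x i * y j) i j * (A i j - p i j) ≤
      B * w) :
    ∑ i, ∑ j, x i * y j * (A' i j - p i j) ≤
      (B + 2 * √(2 * K) + 264 * (4 * Real.exp 2 + D + 4 * c) + 1) * w := by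
  have hn' : (0 : ℝ) < n := Nat.cast_pos.2 hn
  have hxy := sum_sum_mul_sq_le_one hx hy
  have hp' (i j : Fin n) : p i j ≤ w ^ 2 / n := (le_div_iff₀' hn').2 (hp i j)
  have hincident : ∑ i, ∑ j, (if i ∈ S ∨ j ∈ S then |x i * y j| else 0) * p i j ≤ √(2 * K) * w :=
    sum_ite_mem_or_mem_abs_mul_le hw.le (by simpa using hp')
      (by simpa using (div_le_iff₀ hn').2 hS) hxy
  have hheavy_p : ∑ i, ∑ j, heavyPart (w / n) (x i * y j) * p i j ≤ w :=
    calc _ ≤ (w / n)⁻¹ * (w ^ 2 / n) :=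
          (sum_sum_mul_le_sum_sum_mul (fun i j => heavyPart_nonneg _ _) hp').trans
            (mul_le_mul_of_nonneg_right (sum_heavyPart_le (by positivity) hxy) (by positivity))
      _ = w := by field_simp
  have hrow (i : Fin n) : ∑ j, A' i j ≤ D * w ^ 2 := hdeg i
  have hcol (j : Fin n) : ∑ i, A' i j ≤ D * w ^ 2 := by
    simpa only [hA.symm.apply] using hrow j
  have hdisc' := hdisc.mono hn' (pow_pos hw 2) hA.le
  have hheavy : ∑ i, ∑ j, heavyPart (w / n) (x i * y j) * A' i j ≤
      264 * (4 * Real.exp 2 + D + 4 * c) * w :=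
    sum_heavyPart_mul_le hn' hw hc hD hA.nonneg hrow hcol hdisc' (hA.symm.symm ▸ hdisc') hx hy
  linarith [hA.sum_mul_sub_le hp0 (w / n) fun i j => x i * y j]

end IsWeightReduction

namespace IsInhomogeneousER

variable {n : ℕ} {Ω : Type*} [MeasurableSpace Ω] {μ : Measure Ω} [IsProbabilityMeasure μ]
  {p : Matrix (Fin n) (Fin n) ℝ} {A : Ω → Matrix (Fin n) (Fin n) ℝ}

theorem prob_light_le_sum_mul_sub_le (h : IsInhomogeneousER μ p A) (hn : 0 < n) {w : ℝ}
    (hw : 0 < w) (hp : ∀ i j, n * p i j ≤ w ^ 2) {a : Matrix (Fin n) (Fin n) ℝ}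
    (ha : ∀ i j, |a i j| ≤ w / n) (ha2 : ∑ i, ∑ j, a i j ^ 2 ≤ 1) (t : ℝ) :
    μ.real {ω | t * w ≤ ∑ i, ∑ j, a i j * (A ω i j - p i j)} ≤ Real.exp (n / 2 * (1 - t)) := by
  have hn' : (0 : ℝ) < n := Nat.cast_pos.2 hn
  have hvar : ∑ i, ∑ j, p i j * a i j ^ 2 ≤ w ^ 2 / n :=
    calc ∑ i, ∑ j, p i j * a i j ^ 2 ≤ ∑ i, ∑ j, w ^ 2 / n * a i j ^ 2 :=
          Finset.sum_le_sum fun i _ => Finset.sum_le_sum fun j _ =>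
            mul_le_mul_of_nonneg_right ((le_div_iff₀' hn').2 (hp i j)) (sq_nonneg _)
      _ = w ^ 2 / n * ∑ i, ∑ j, a i j ^ 2 := by simp only [← Finset.mul_sum]
      _ ≤ w ^ 2 / n := mul_le_of_le_one_right (by positivity) ha2
  have hsmall (i j : Fin n) : |2 * (n / (2 * w) * a i j)| ≤ 1 := by
    rw [← mul_assoc, abs_mul, abs_of_pos (by positivity)]
    calc 2 * (n / (2 * w)) * |a i j| ≤ 2 * (n / (2 * w)) * (w / n) := by gcongr; exact ha i j
      _ = 1 := by field_simp
  refine (h.prob_le_sum_mul_sub_le (by positivity) hsmall _).trans (Real.exp_le_exp.2 ?_)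
  calc 2 * (n / (2 * w)) ^ 2 * ∑ i, ∑ j, p i j * a i j ^ 2 - n / (2 * w) * (t * w)
      ≤ 2 * (n / (2 * w)) ^ 2 * (w ^ 2 / n) - n / (2 * w) * (t * w) := by gcongr
    _ = n / 2 * (1 - t) := by field_simp

theorem prob_exists_light_le_sum_mul_sub_le (h : IsInhomogeneousER μ p A) (hn : 0 < n) {w : ℝ}
    (hw : 0 < w) (hp : ∀ i j, n * p i j ≤ w ^ 2) {κ : Type*} {s : Finset κ} {b : ℝ}
    (hs : #s ≤ Real.exp (b * n)) {a : κ → Matrix (Fin n) (Fin n) ℝ}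
    (ha : ∀ k ∈ s, ∀ i j, |a k i j| ≤ w / n) (ha2 : ∀ k ∈ s, ∑ i, ∑ j, a k i j ^ 2 ≤ 1) {r : ℝ}
    (hr : 0 ≤ r) :
    μ.real {ω | ∃ k ∈ s, (2 * (r + b) + 3) * w ≤ ∑ i, ∑ j, a k i j * (A ω i j - p i j)} ≤
      (n : ℝ) ^ (-r) / 2 := by
  have hn' : (1 : ℝ) ≤ n := Nat.one_le_cast.2 hn
  have hlog := Real.log_le_self (zero_le_one.trans hn')
  have hunion : {ω | ∃ k ∈ s, (2 * (r + b) + 3) * w ≤ ∑ i, ∑ j, a k i j * (A ω i j - p i j)} =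
      ⋃ k ∈ s, {ω | (2 * (r + b) + 3) * w ≤ ∑ i, ∑ j, a k i j * (A ω i j - p i j)} := by
    ext ω
    simp
  rw [hunion]
  calc _ ≤ ∑ k ∈ s, μ.real {ω | (2 * (r + b) + 3) * w ≤ ∑ i, ∑ j, a k i j * (A ω i j - p i j)} :=
        measureReal_biUnion_finset_le _ _
    _ ≤ #s * Real.exp (n / 2 * (1 - (2 * (r + b) + 3))) := by
        rw [← nsmul_eq_mul]
        exact Finset.sum_le_card_nsmul _ _ _ fun k hk =>
          h.prob_light_le_sum_mul_sub_le hn hw hp (ha k hk) (ha2 k hk) _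
    _ ≤ Real.exp (b * n) * Real.exp (n / 2 * (1 - (2 * (r + b) + 3))) := by gcongr
    _ = Real.exp (n * -r) * Real.exp (-n) := by
        rw [← Real.exp_add, ← Real.exp_add]
        ring_nf
    _ ≤ Real.exp (Real.log n * -r) * 2⁻¹ := by
        rw [Real.exp_neg n]
        have hexp := Real.add_one_le_exp (n : ℝ)
        have hlogr := mul_le_mul_of_nonpos_right hlog (neg_nonpos.2 hr)
        gcongr ?_ * ?_⁻¹
        · exact Real.exp_le_exp.2 hlogr
        · linarith
    _ = (n : ℝ) ^ (-r) / 2 := by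
        rw [Real.rpow_def_of_pos (by positivity), div_eq_mul_inv]

theorem exists_isCover_half_prob_light_le (h : IsInhomogeneousER μ p A) (hn : 0 < n) {w : ℝ}
    (hw : 0 < w) (hp : ∀ i j, n * p i j ≤ w ^ 2) {r : ℝ} (hr : 0 ≤ r) :
    ∃ N : Set (EuclideanSpace ℝ (Fin n)), N ⊆ Metric.closedBall 0 1 ∧
      Metric.IsCover (1 / 2) (Metric.closedBall 0 1) N ∧
      μ.real {ω | ∃ x ∈ N, ∃ y ∈ N, ∃ S, (2 * (r + 4) + 3) * w ≤ ∑ i, ∑ j,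
        lightWeight (w / n) S (fun i j => x i * y j) i j * (A ω i j - p i j)} ≤
        (n : ℝ) ^ (-r) / 2 := by
  obtain ⟨N, hcard, hball, hcover⟩ := exists_isCover_half_card_le (EuclideanSpace ℝ (Fin n))
  rw [finrank_euclideanSpace_fin] at hcard
  have hs : (#((N ×ˢ N) ×ˢ (Finset.univ : Finset (Finset (Fin n)))) : ℝ) ≤ Real.exp (4 * n) := by
    have h50 : (50 : ℝ) ≤ Real.exp 4 := by
      calc (50 : ℝ) ≤ 2.7 ^ 4 := by norm_num
        _ ≤ Real.exp 1 ^ 4 := by gcongr; linarith [Real.exp_one_gt_d9]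
        _ = Real.exp 4 := by rw [← Real.exp_nat_mul]; norm_num
    calc (#((N ×ˢ N) ×ˢ (Finset.univ : Finset (Finset (Fin n)))) : ℝ)
        = #N * #N * 2 ^ n := by simp
      _ ≤ 5 ^ n * 5 ^ n * 2 ^ n := by gcongr <;> exact_mod_cast hcard
      _ = 50 ^ n := by rw [← mul_pow, ← mul_pow]; norm_num
      _ ≤ Real.exp 4 ^ n := by gcongr
      _ = Real.exp (4 * n) := by rw [← Real.exp_nat_mul, mul_comm]
  refine ⟨N, hball, hcover, le_trans (measureReal_mono ?_ (measure_ne_top _ _)) <|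
    h.prob_exists_light_le_sum_mul_sub_le hn hw hp hs
      (a := fun k => lightWeight (w / n) k.2 fun i j => k.1.1 i * k.1.2 j) ?_ ?_ hr⟩
  · rintro ω ⟨x, hx, y, hy, S, hω⟩
    exact ⟨((x, y), S), by simpa using ⟨hx, hy⟩, hω⟩
  · intro k _ i j
    exact (abs_lightWeight _ _ _ i j).trans_le (abs_cutoff_le (by positivity) _)
  · rintro ⟨⟨x, y⟩, S⟩ hk
    have hk : x ∈ N ∧ y ∈ N := by simpa using hk
    exact (sum_lightWeight_sq_le _ _ _).trans <|
      sum_sum_mul_sq_le_one (sum_sq_le_one_of_mem_closedBall (hball hk.1))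
        (sum_sq_le_one_of_mem_closedBall (hball hk.2))

theorem one_sub_rpow_le_prob_norm_sub_le (h : IsInhomogeneousER μ p A) (hn : 0 < n) {w : ℝ}
    (hw : 0 < w) (hp : ∀ i j, n * p i j ≤ w ^ 2) (K : ℝ) {D r : ℝ} (hD : 0 ≤ D) (hr : 0 ≤ r) :
    1 - (n : ℝ) ^ (-r) ≤
      μ.real {ω | ∀ (S : Finset (Fin n)) (A' : Matrix (Fin n) (Fin n) ℝ),
        #S * w ^ 2 ≤ K * n → IsWeightReduction (A ω) S A' →
        (∀ i, weightedDegree A' i ≤ D * w ^ 2) →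
        matrixSpectralNorm (A' - p) ≤ 4 * ((2 * (r + 4) + 3 + 2 * √(2 * K) +
          264 * (4 * Real.exp 2 + D + 4 * (4 * (r + 3))) + 1) * w)} := by
  obtain ⟨N, hball, hcover, hlight⟩ := h.exists_isCover_half_prob_light_le hn hw hp hr
  have hdisc := h.prob_not_hasDiscrepancy_le hn (pow_pos hw 2) hp hr
  set Light : Set Ω := {ω | ∃ x ∈ N, ∃ y ∈ N, ∃ S, (2 * (r + 4) + 3) * w ≤ ∑ i, ∑ j,
    lightWeight (w / n) S (fun i j => x i * y j) i j * (A ω i j - p i j)}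
  set Disc : Set Ω := {ω | ¬HasDiscrepancy n (w ^ 2) (4 * (r + 3)) (A ω)}
  have hgood : 1 - (n : ℝ) ^ (-r) ≤ μ.real (Light ∪ Disc)ᶜ := by
    have hone := measureReal_union_le (μ := μ) (Light ∪ Disc) (Light ∪ Disc)ᶜ
    rw [Set.union_compl_self, probReal_univ] at hone
    linarith [measureReal_union_le (μ := μ) Light Disc]
  refine hgood.trans (measureReal_mono (fun ω hω S A' hS hA' hdeg => ?_) (measure_ne_top _ _))
  obtain ⟨hωlight, hωdisc⟩ := not_or.1 hω
  refine matrixSpectralNorm_le_of_isCover_half hcover fun x hx y hy => ?_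
  refine hA'.bilinear_sub_le hn hw h.prob_nonneg hp hS (by positivity) hD hdeg (not_not.1 hωdisc)
    (sum_sq_le_one_of_mem_closedBall (hball hx)) (sum_sq_le_one_of_mem_closedBall (hball hy)) ?_
  exact (not_le.1 fun hle => hωlight ⟨x, hx, y, hy, S, hle⟩).le

end IsInhomogeneousER

theorem eq_zero_of_weightedDegree_nonpos {n : ℕ} {M : Matrix (Fin n) (Fin n) ℝ}
    (hM : ∀ i j, 0 ≤ M i j) (hdeg : ∀ i, weightedDegree M i ≤ 0) : M = 0 := by
  ext i j
  exact (Finset.sum_eq_zero_iff_of_nonneg fun j _ => hM i j).1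
    ((hdeg i).antisymm (Finset.sum_nonneg fun j _ => hM i j)) j (Finset.mem_univ j)

theorem IsWeightReduction.eq_of_nonpos {n : ℕ} {A A' p : Matrix (Fin n) (Fin n) ℝ}
    {S : Finset (Fin n)} (hA : IsWeightReduction A S A') (hp0 : ∀ i j, 0 ≤ p i j)
    (hp : ∀ i j, n * p i j ≤ 0) (hdeg : ∀ i, weightedDegree A' i ≤ 0) : A' = p := by
  rw [eq_zero_of_weightedDegree_nonpos hA.nonneg hdeg]
  ext i j
  exact (hp0 i j).antisymm (nonpos_of_mul_nonpos_right (hp i j) (Nat.cast_pos.2 i.pos))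

theorem mainTheorem1_general (K : ℝ) {D : ℝ} (hD : 0 ≤ D) :
    ∃ C : ℝ, 0 < C ∧
      ∀ (n : ℕ) (Ω : Type*) [MeasurableSpace Ω] (μ : Measure Ω) [IsProbabilityMeasure μ]
        (p : Matrix (Fin n) (Fin n) ℝ) (A : Ω → Matrix (Fin n) (Fin n) ℝ) (d : ℝ),
        IsInhomogeneousER μ p A →
        (∀ i j, n * p i j ≤ d) →
        ∀ r : ℝ, 1 ≤ r →
          1 - (n : ℝ) ^ (-r) ≤
            μ.real {ω | ∀ (S : Finset (Fin n)) (A' : Matrix (Fin n) (Fin n) ℝ),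
              #S * d ≤ K * n →
              IsWeightReduction (A ω) S A' →
              (∀ i, weightedDegree A' i ≤ D * d) →
              matrixSpectralNorm (A' - expectedMatrix μ A) ≤ C * r * √d} := by
  refine ⟨4 * (14 + 2 * √(2 * K) + 264 * (4 * Real.exp 2 + D + 64)), by positivity, ?_⟩
  intro n Ω _ μ _ p A d h hp r hr
  rw [h.expectedMatrix_eq]
  by_cases hpos : 0 < n ∧ 0 < d
  · obtain ⟨hn, hd⟩ := hpos
    have hw : √d ^ 2 = d := Real.sq_sqrt hd.le
    have hprob := h.one_sub_rpow_le_prob_norm_sub_le hn (Real.sqrt_pos.2 hd) (by rwa [hw]) K hD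
      (by linarith : 0 ≤ r)
    simp only [hw] at hprob
    refine hprob.trans (measureReal_mono (fun ω hω S A' hS hA' hdeg => ?_) (measure_ne_top _ _))
    refine (hω S A' hS hA' hdeg).trans ?_
    rw [← mul_assoc]
    refine mul_le_mul_of_nonneg_right ?_ (Real.sqrt_nonneg d)
    have hrest : 0 ≤ 2 * √(2 * K) + 264 * (4 * Real.exp 2 + D) := by positivity
    linarith [le_mul_of_one_le_right hrest hr]
  · have huniv : 1 - (n : ℝ) ^ (-r) ≤ μ.real Set.univ := by
      rw [probReal_univ]
      linarith [Real.rpow_nonneg n.cast_nonneg (-r)]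
    refine huniv.trans (measureReal_mono (fun ω _ S A' _ hA' hdeg => ?_) (measure_ne_top _ _))
    have hd (i : Fin n) : d ≤ 0 := not_lt.1 fun hd => hpos ⟨i.pos, hd⟩
    have hA'p : A' = p := hA'.eq_of_nonpos h.prob_nonneg (fun i j => (hp i j).trans (hd i))
      fun i => (hdeg i).trans (mul_nonpos_of_nonneg_of_nonpos hD (hd i))
    rw [hA'p, sub_self, matrixSpectralNorm, map_zero, norm_zero]
    positivity

theorem mainTheorem1 :
    ∃ C : ℝ, 0 < C ∧
      ∀ (n : ℕ) (Ω : Type*) [MeasurableSpace Ω] (μ : Measure Ω) [IsProbabilityMeasure μ]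
        (p : Matrix (Fin n) (Fin n) ℝ) (A : Ω → Matrix (Fin n) (Fin n) ℝ) (d : ℝ),
        IsInhomogeneousER μ p A →
        IsGreatest (Set.range fun e : Fin n × Fin n => (n : ℝ) * p e.1 e.2) d →
        ∀ r : ℝ, 1 ≤ r →
          1 - (n : ℝ) ^ (-r) ≤
            μ.real {ω | ∀ (S : Finset (Fin n)) (A' : Matrix (Fin n) (Fin n) ℝ),
              (S.card : ℝ) * d ≤ 10 * n →
              IsWeightReduction (A ω) S A' →
              (∀ i, weightedDegree A' i ≤ 2 * d) →
              matrixSpectralNorm (A' - expectedMatrix μ A) ≤ C * r ^ (3 / 2 : ℝ) * Real.sqrt d} := by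
  obtain ⟨C, hC, hprob⟩ := mainTheorem1_general 10 zero_le_two
  refine ⟨C, hC, fun n Ω _ μ _ p A d h hd r hr => ?_⟩
  refine (hprob n Ω μ p A d h (fun i j => hd.2 ⟨(i, j), rfl⟩) r hr).trans <|
    measureReal_mono (fun ω hω S A' hS hA' hdeg => ?_) (measure_ne_top _ _)
  refine (hω S A' hS hA' hdeg).trans ?_
  gcongr
  exact Real.self_le_rpow_of_one_le hr (by norm_num)
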